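/- Let $K$ be a field and let $Q=\bigoplus_{i\ge 0}Q_i$ be a standard graded commutative $K$-algebra; that is, $Q_0=K$, $Q$ is generated as a $K$-algebra by $Q_1$, and $\dim_K Q_1<\infty$. Let $R$ be a commutative graded $K$-algebra, let $\varphi\colon Q\to R$ be a surjective homomorphism of graded $K$-algebras, and let $J=\operatorname{Ker}\varphi$. Put $Q_+=\bigoplus_{i\ge1}Q_i$ and $k=Q/Q_+=R/R_+$. For a $\mathbb Z$-graded $Q$-module $N$, let $\operatorname{Tor}^Q_i(k,N)_j$ denote the component of internal degree $j$ of $\operatorname{Tor}^Q_i(k,N)$, and similarly over $R$. For a $\mathbb Z$-graded $R$-module $M$, regarded as a $Q$-module through $\varphi$, let $\operatorname{Tor}^{\varphi}_i(k,M)_j\colon\operatorname{Tor}^Q_i(k,M)_j\to\operatorname{Tor}^R_i(k,M)_j$ be the canonical change-of-rings homomorphism. The algebra $Q$ is called Koszul if its residue field has regularity $\operatorname{reg}_Q k=\sup_{i\ge0}\bigl(\sup\{j\mid\operatorname{Tor}^Q_i(k,k)_j\ne0\}-i\bigr)$ equal to $0$. A graded module $M$ is called Koszul over $Q$ if $\operatorname{Tor}^Q_i(k,M)_j=0$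 unless $i=j$. The homomorphism $\varphi$ is called small if $\operatorname{Tor}^\varphi_i(k,k)_j$ is injective for all $i\ge0$ and $j\in\mathbb Z$. Assume that $J\subseteq(Q_+)^2$. (1) If $Q$ is Koszul, then $\varphi$ is small. (2) If $\varphi$ is small and $M$ is a $\mathbb Z$-graded $R$-module that is Koszul over $Q$, then $\operatorname{Tor}^{\varphi}_i(k,M)_j$ is injective for all $i\ge0$ and $j\in\mathbb Z$. -/

import Mathlib

universe u v

noncomputable section

namespace KoszulTor

variable {K : Type v} [Field K]

/-! ## Graded modules and graded free modules -/

/-- The grading of an `ℕ`-graded algebra, extended by zero to negative degrees. -/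
def intPiece {A : Type u} [CommRing A] [Algebra K A] (𝒜 : ℕ → Submodule K A) (j : ℤ) :
    Submodule K A :=
  if 0 ≤ j then 𝒜 j.toNat else ⊥

/-- `𝒩` is a `ℤ`-grading of the `A`-module `N`, making it a graded module over the graded
algebra `(A, 𝒜)`. -/
structure IsGradedModule {A : Type u} [CommRing A] [Algebra K A] (𝒜 : ℕ → Submodule K A)
    {N : Type u} [AddCommGroup N] [Module A N] (𝒩 : ℤ → AddSubgroup N) : Prop where
  isInternal : DirectSum.IsInternal 𝒩
  smul_mem : ∀ (i : ℕ) (j : ℤ) (a : A) (n : N), a ∈ 𝒜 i → n ∈ 𝒩 j → a • n ∈ 𝒩 ((i : ℤ) + j)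

/-- The component of degree `j` of the graded free module `⨁ b, A(-deg b)`: the
`b`-coordinate lies in `A_{j - deg b}`. -/
def freePiece {A : Type u} [CommRing A] [Algebra K A] (𝒜 : ℕ → Submodule K A)
    {ι : Type u} (deg : ι → ℤ) (j : ℤ) : Submodule K (ι →₀ A) where
  carrier := {x | ∀ b, x b ∈ intPiece 𝒜 (j - deg b)}
  add_mem' hx hy b := add_mem (hx b) (hy b)
  zero_mem' _ := zero_mem _
  smul_mem' c _ hx b := Submodule.smul_mem _ c (hx b)

/-! ## The standard graded free resolution

`F_0` is free on the homogeneous elements of `N`, and `F_{n+1}` is free on the homogeneous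
elements of the kernel of `F_n → F_{n-1}` (of `F_0 → N` when `n = 0`). -/

/-- A free `A`-module with a basis `ι` with assigned degrees, and the submodule `rel` that the
next step of the resolution has to cover. -/
structure Stage (A : Type u) [CommRing A] where
  ι : Type u
  deg : ι → ℤ
  rel : Submodule A (ι →₀ A)

/-- The homogeneous elements of `rel`, together with their degrees. -/
abbrev Stage.Gen {A : Type u} [CommRing A] [Algebra K A] (𝒜 : ℕ → Submodule K A) (S : Stage A) :
    Type u :=
  Σ j : ℤ, {x : S.ι →₀ A // x ∈ S.rel ∧ x ∈ freePiece 𝒜 S.deg j}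

/-- The map that sends the basis element of a homogeneous element to that element. -/
def Stage.diff {A : Type u} [CommRing A] [Algebra K A] (𝒜 : ℕ → Submodule K A) (S : Stage A) :
    (S.Gen 𝒜 →₀ A) →ₗ[A] (S.ι →₀ A) :=
  Finsupp.linearCombination A fun b : S.Gen 𝒜 => (b.2.1 : S.ι →₀ A)

/-- The next step of the resolution: it covers `S.rel`. -/
abbrev Stage.next {A : Type u} [CommRing A] [Algebra K A] (𝒜 : ℕ → Submodule K A) (S : Stage A) :
    Stage A where
  ι := S.Gen 𝒜
  deg b := b.1
  rel := LinearMap.ker (S.diff 𝒜)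

/-- The augmentation `F_0 → N`. -/
def augmentation (A : Type u) [CommRing A] {N : Type u} [AddCommGroup N] [Module A N]
    (𝒩 : ℤ → AddSubgroup N) : ((Σ j : ℤ, 𝒩 j) →₀ A) →ₗ[A] N :=
  Finsupp.linearCombination A fun b : (Σ j : ℤ, 𝒩 j) => (b.2 : N)

/-- The stages of the standard graded free resolution of `N` over `A`. -/
def stage {A : Type u} [CommRing A] [Algebra K A] (𝒜 : ℕ → Submodule K A)
    {N : Type u} [AddCommGroup N] [Module A N] (𝒩 : ℤ → AddSubgroup N) : ℕ → Stage A
  | 0 => ⟨Σ j : ℤ, 𝒩 j, fun b => b.1, LinearMap.ker (augmentation A 𝒩)⟩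
  | n + 1 => (stage 𝒜 𝒩 n).next 𝒜

/-- The free module `F_n` of the standard resolution. -/
abbrev F {A : Type u} [CommRing A] [Algebra K A] (𝒜 : ℕ → Submodule K A)
    {N : Type u} [AddCommGroup N] [Module A N] (𝒩 : ℤ → AddSubgroup N) (n : ℕ) : Type u :=
  (stage 𝒜 𝒩 n).ι →₀ A

/-- The differential `F_{n+1} → F_n` of the standard resolution. -/
def d {A : Type u} [CommRing A] [Algebra K A] (𝒜 : ℕ → Submodule K A)
    {N : Type u} [AddCommGroup N] [Module A N] (𝒩 : ℤ → AddSubgroup N) (n : ℕ) :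
    F 𝒜 𝒩 (n + 1) →ₗ[A] F 𝒜 𝒩 n :=
  (stage 𝒜 𝒩 n).diff 𝒜

/-! ### The standard resolution is a graded free resolution -/

theorem smul_mem_intPiece {A : Type u} [CommRing A] [Algebra K A] (𝒜 : ℕ → Submodule K A)
    [GradedAlgebra 𝒜] {i : ℕ} {j : ℤ} {a x : A} (ha : a ∈ 𝒜 i) (hx : x ∈ intPiece 𝒜 j) :
    a * x ∈ intPiece 𝒜 ((i : ℤ) + j) := by
  unfold intPiece at hx ⊢
  split_ifs at hx with h
  · rw [if_pos (by omega)]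
    have : ((i : ℤ) + j).toNat = i + j.toNat := by omega
    rw [this]
    exact SetLike.mul_mem_graded ha hx
  · rw [(Submodule.mem_bot K).1 hx, mul_zero]
    exact zero_mem _

/-- If `f` maps the generators of a graded free module to elements of the same degree, then its
kernel is spanned by homogeneous elements. -/
theorem ker_le_span {A : Type u} [CommRing A] [Algebra K A] (𝒜 : ℕ → Submodule K A)
    [GradedAlgebra 𝒜] {ι : Type u} (deg : ι → ℤ) {N : Type u} [AddCommGroup N] [Module A N]
    (𝒩 : ℤ → AddSubgroup N)
    (hN : ∀ (s : Finset ℤ) (y : ℤ → N), (∀ j ∈ s, y j ∈ 𝒩 j) → ∑ j ∈ s, y j = 0 →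
      ∀ j ∈ s, y j = 0)
    (f : (ι →₀ A) →ₗ[A] N)
    (hf : ∀ (b : ι) (i : ℕ) (a : A), a ∈ 𝒜 i → f (Finsupp.single b a) ∈ 𝒩 ((i : ℤ) + deg b))
    (x : ι →₀ A) (hx : f x = 0) :
    x ∈ Submodule.span A {y : ι →₀ A | f y = 0 ∧ ∃ j, y ∈ freePiece 𝒜 deg j} := by
  classical
  -- every element is a finite sum of homogeneous ones
  have key : ∀ x : ι →₀ A, ∃ c : ℤ →₀ (ι →₀ A),
      (∀ j, c j ∈ freePiece 𝒜 deg j ∧ f (c j) ∈ 𝒩 j) ∧ (c.sum fun _ y => y) = x := by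
    intro x
    induction x using Finsupp.induction_linear with
    | zero => exact ⟨0, fun j => ⟨zero_mem _, by simp⟩, by simp⟩
    | add x y hx hy =>
      obtain ⟨c, hc, rfl⟩ := hx
      obtain ⟨e, he, rfl⟩ := hy
      refine ⟨c + e, fun j => ⟨add_mem (hc j).1 (he j).1, ?_⟩, ?_⟩
      · rw [Finsupp.add_apply, map_add]
        exact add_mem (hc j).2 (he j).2
      · rw [Finsupp.sum_add_index'] <;> simp
    | single b a =>
      induction a using DirectSum.Decomposition.inductionOn 𝒜 with
      | zero => exact ⟨0, fun j => ⟨zero_mem _, by simp⟩, by simp⟩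
      | @homogeneous i a =>
        refine ⟨Finsupp.single ((i : ℤ) + deg b) (Finsupp.single b (a : A)), fun j => ?_, by simp⟩
        by_cases hj : (i : ℤ) + deg b = j
        · subst hj
          rw [Finsupp.single_eq_same]
          refine ⟨fun b' => ?_, hf b i a a.2⟩
          by_cases hb : b = b'
          · subst hb
            rw [Finsupp.single_eq_same, intPiece, if_pos (by omega)]
            have : ((i : ℤ) + deg b - deg b).toNat = i := by omega
            rw [this]
            exact a.2
          · rw [Finsupp.single_eq_of_ne' hb]
            exact zero_mem _
        · rw [Finsupp.single_eq_of_ne' hj]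
          exact ⟨zero_mem _, by simp⟩
      | add a a' hx hy =>
        obtain ⟨c, hc, hc'⟩ := hx
        obtain ⟨e, he, he'⟩ := hy
        refine ⟨c + e, fun j => ⟨add_mem (hc j).1 (he j).1, ?_⟩, ?_⟩
        · rw [Finsupp.add_apply, map_add]
          exact add_mem (hc j).2 (he j).2
        · rw [Finsupp.sum_add_index' (by simp) (by simp), hc', he', Finsupp.single_add]
  obtain ⟨c, hc, rfl⟩ := key x
  have hz : ∀ j ∈ c.support, f (c j) = 0 := by
    refine hN c.support (fun j => f (c j)) (fun j _ => (hc j).2) ?_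
    rw [← map_sum]
    exact hx
  exact Submodule.sum_mem _ fun j hj => Submodule.subset_span ⟨hz j hj, j, (hc j).1⟩

theorem IsGradedModule.eq_zero_of_sum {A : Type u} [CommRing A] [Algebra K A]
    {𝒜 : ℕ → Submodule K A} {N : Type u} [AddCommGroup N] [Module A N] {𝒩 : ℤ → AddSubgroup N}
    (h : IsGradedModule 𝒜 𝒩) (s : Finset ℤ) (y : ℤ → N) (hy : ∀ j ∈ s, y j ∈ 𝒩 j)
    (h0 : ∑ j ∈ s, y j = 0) : ∀ j ∈ s, y j = 0 := by
  classical
  have hz : (∑ j ∈ s.attach, DirectSum.of (fun j => 𝒩 j) j.1 ⟨y j.1, hy j.1 j.2⟩) = 0 := by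
    apply h.isInternal.injective
    rw [map_sum, map_zero, ← h0, ← Finset.sum_attach s y]
    exact Finset.sum_congr rfl fun j _ => DirectSum.coeAddMonoidHom_of _ _ _
  intro j hj
  have hj' := congrArg (fun z => ((z j : 𝒩 j) : N)) hz
  simp only [DirectSum.sum_apply, AddSubmonoidClass.coe_finsetSum, DirectSum.zero_apply,
    ZeroMemClass.coe_zero] at hj'
  rw [Finset.sum_eq_single ⟨j, hj⟩] at hj'
  · simpa using hj'
  · intro b _ hb
    rw [DirectSum.of_eq_of_ne _ _ _ (fun e => hb (Subtype.ext e.symm))]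
    simp
  · intro hb
    exact absurd (Finset.mem_attach _ _) hb

theorem freePiece_eq_zero_of_sum {A : Type u} [CommRing A] [Algebra K A]
    (𝒜 : ℕ → Submodule K A) [GradedAlgebra 𝒜] {ι : Type u} (deg : ι → ℤ) (s : Finset ℤ)
    (y : ℤ → ι →₀ A) (hy : ∀ j ∈ s, y j ∈ (freePiece 𝒜 deg j).toAddSubgroup)
    (h0 : ∑ j ∈ s, y j = 0) : ∀ j ∈ s, y j = 0 := by
  classical
  intro j hj
  ext b
  have hb : ∑ l ∈ s, y l b = 0 := by
    rw [← Finsupp.finsetSum_apply, h0, Finsupp.zero_apply]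
  have hmem : ∀ l ∈ s, y l b ∈ intPiece 𝒜 (l - deg b) := fun l hl => hy l hl b
  by_cases hpos : 0 ≤ j - deg b
  · have hp := congrArg (GradedRing.proj 𝒜 (j - deg b).toNat) hb
    rw [map_sum, map_zero, Finset.sum_eq_single j] at hp
    · have h1 := hmem j hj
      rw [intPiece, if_pos hpos] at h1
      rwa [GradedRing.proj_apply, DirectSum.decompose_of_mem_same 𝒜 h1] at hp
    · intro l hl hlj
      have h1 := hmem l hl
      unfold intPiece at h1
      split_ifs at h1 with h2
      · rw [GradedRing.proj_apply, DirectSum.decompose_of_mem_ne 𝒜 h1 (by omega)]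
      · rw [(Submodule.mem_bot K).1 h1, map_zero]
    · intro h
      exact absurd hj h
  · have h1 := hmem j hj
    rw [intPiece, if_neg hpos] at h1
    simpa using h1

theorem diff_single_mem {A : Type u} [CommRing A] [Algebra K A] (𝒜 : ℕ → Submodule K A)
    [GradedAlgebra 𝒜] (S : Stage A) (b : S.Gen 𝒜) (i : ℕ) (a : A) (ha : a ∈ 𝒜 i) :
    S.diff 𝒜 (Finsupp.single b a) ∈ freePiece 𝒜 S.deg ((i : ℤ) + b.1) := by
  intro b'
  rw [Stage.diff, Finsupp.linearCombination_single, Finsupp.smul_apply, smul_eq_mul,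
    add_sub_assoc]
  exact smul_mem_intPiece 𝒜 ha (b.2.2.2 b')

theorem augmentation_single_mem {A : Type u} [CommRing A] [Algebra K A] {𝒜 : ℕ → Submodule K A}
    {N : Type u} [AddCommGroup N] [Module A N] {𝒩 : ℤ → AddSubgroup N}
    (h : IsGradedModule 𝒜 𝒩) (b : Σ j : ℤ, 𝒩 j) (i : ℕ) (a : A) (ha : a ∈ 𝒜 i) :
    augmentation A 𝒩 (Finsupp.single b a) ∈ 𝒩 ((i : ℤ) + b.1) := by
  rw [augmentation, Finsupp.linearCombination_single]
  exact h.smul_mem i b.1 a _ ha b.2.2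

theorem augmentation_surjective {A : Type u} [CommRing A] [Algebra K A] {𝒜 : ℕ → Submodule K A}
    {N : Type u} [AddCommGroup N] [Module A N] {𝒩 : ℤ → AddSubgroup N}
    (h : IsGradedModule 𝒜 𝒩) : Function.Surjective (augmentation A 𝒩) := by
  classical
  intro n
  obtain ⟨z, rfl⟩ := h.isInternal.surjective n
  induction z using DirectSum.induction_on with
  | zero => exact ⟨0, by simp⟩
  | of j x => exact ⟨Finsupp.single ⟨j, x⟩ 1, by simp [augmentation]⟩
  | add x y hx hy =>
    obtain ⟨x', hx⟩ := hx
    obtain ⟨y', hy⟩ := hy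
    exact ⟨x' + y', by rw [map_add, map_add, hx, hy]⟩

/-- The differential of the standard resolution covers the kernel of the preceding map. -/
theorem range_d {A : Type u} [CommRing A] [Algebra K A] (𝒜 : ℕ → Submodule K A)
    [GradedAlgebra 𝒜] {N : Type u} [AddCommGroup N] [Module A N] {𝒩 : ℤ → AddSubgroup N}
    (h : IsGradedModule 𝒜 𝒩) (n : ℕ) :
    LinearMap.range (d 𝒜 𝒩 n) = (stage 𝒜 𝒩 n).rel := by
  have hspan : ∀ S : Stage A, LinearMap.range (S.diff 𝒜) =
      Submodule.span A {y | y ∈ S.rel ∧ ∃ j, y ∈ freePiece 𝒜 S.deg j} := by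
    intro S
    rw [Stage.diff, Finsupp.range_linearCombination]
    congr 1
    ext y
    constructor
    · rintro ⟨b, rfl⟩
      exact ⟨b.2.2.1, b.1, b.2.2.2⟩
    · rintro ⟨hy, j, hj⟩
      exact ⟨⟨j, y, hy, hj⟩, rfl⟩
  refine (hspan (stage 𝒜 𝒩 n)).trans ?_
  apply le_antisymm
  · rw [Submodule.span_le]
    exact fun y hy => hy.1
  · intro x hx
    cases n with
    | zero =>
      exact ker_le_span 𝒜 _ 𝒩 h.eq_zero_of_sum (augmentation A 𝒩)
        (augmentation_single_mem h) x hx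
    | succ n =>
      exact ker_le_span 𝒜 _ (fun j => (freePiece 𝒜 (stage 𝒜 𝒩 n).deg j).toAddSubgroup)
        (freePiece_eq_zero_of_sum 𝒜 _) ((stage 𝒜 𝒩 n).diff 𝒜)
        (diff_single_mem 𝒜 _) x hx

/-- The standard resolution `⋯ → F_1 → F_0 → N → 0` is exact. -/
theorem standard_exact {A : Type u} [CommRing A] [Algebra K A] (𝒜 : ℕ → Submodule K A)
    [GradedAlgebra 𝒜] {N : Type u} [AddCommGroup N] [Module A N] {𝒩 : ℤ → AddSubgroup N}
    (h : IsGradedModule 𝒜 𝒩) :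
    Function.Surjective (augmentation A 𝒩) ∧
      LinearMap.range (d 𝒜 𝒩 0) = LinearMap.ker (augmentation A 𝒩) ∧
      ∀ n, LinearMap.range (d 𝒜 𝒩 (n + 1)) = LinearMap.ker (d 𝒜 𝒩 n) :=
  ⟨augmentation_surjective h, range_d 𝒜 h 0, fun n => range_d 𝒜 h (n + 1)⟩

/-! ## Tor

`k ⊗_A F = F / A_+ F` for `k = A / A_+`. -/

/-- `A_+ F`, as a `K`-subspace. -/
def plus {A : Type u} [CommRing A] [Algebra K A] (𝒜 : ℕ → Submodule K A) [GradedAlgebra 𝒜]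
    (ι : Type u) : Submodule K (ι →₀ A) :=
  ((HomogeneousIdeal.irrelevant 𝒜).toIdeal • (⊤ : Submodule A (ι →₀ A))).restrictScalars K

/-- `k ⊗_A F_n`. -/
abbrev Fbar {A : Type u} [CommRing A] [Algebra K A] (𝒜 : ℕ → Submodule K A) [GradedAlgebra 𝒜]
    {N : Type u} [AddCommGroup N] [Module A N] (𝒩 : ℤ → AddSubgroup N) (n : ℕ) : Type u :=
  F 𝒜 𝒩 n ⧸ plus 𝒜 (stage 𝒜 𝒩 n).ι

theorem plus_le_comap {A : Type u} [CommRing A] [Algebra K A] (𝒜 : ℕ → Submodule K A)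
    [GradedAlgebra 𝒜] {ι ι' : Type u} (f : (ι →₀ A) →ₗ[A] (ι' →₀ A)) :
    plus 𝒜 ι ≤ (plus 𝒜 ι').comap (f.restrictScalars K) := by
  intro x hx
  have h : (HomogeneousIdeal.irrelevant 𝒜).toIdeal • (⊤ : Submodule A (ι →₀ A)) ≤
      ((HomogeneousIdeal.irrelevant 𝒜).toIdeal • (⊤ : Submodule A (ι' →₀ A))).comap f := by
    rw [← Submodule.map_le_iff_le_comap, Submodule.map_smul'']
    exact Submodule.smul_mono le_rfl le_top
  exact h hx

/-- The differential `k ⊗_A F_{n+1} → k ⊗_A F_n`. -/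
def dbar {A : Type u} [CommRing A] [Algebra K A] (𝒜 : ℕ → Submodule K A) [GradedAlgebra 𝒜]
    {N : Type u} [AddCommGroup N] [Module A N] (𝒩 : ℤ → AddSubgroup N) (n : ℕ) :
    Fbar 𝒜 𝒩 (n + 1) →ₗ[K] Fbar 𝒜 𝒩 n :=
  Submodule.mapQ _ _ ((d 𝒜 𝒩 n).restrictScalars K) (plus_le_comap 𝒜 (d 𝒜 𝒩 n))

/-- The component of internal degree `j` of `k ⊗_A F_n`. -/
def strand {A : Type u} [CommRing A] [Algebra K A] (𝒜 : ℕ → Submodule K A) [GradedAlgebra 𝒜]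
    {N : Type u} [AddCommGroup N] [Module A N] (𝒩 : ℤ → AddSubgroup N) (n : ℕ) (j : ℤ) :
    Submodule K (Fbar 𝒜 𝒩 n) :=
  (freePiece 𝒜 (stage 𝒜 𝒩 n).deg j).map (plus 𝒜 (stage 𝒜 𝒩 n).ι).mkQ

/-- The cycles of homological degree `i` and internal degree `j` of `k ⊗_A F`. -/
def cycles {A : Type u} [CommRing A] [Algebra K A] (𝒜 : ℕ → Submodule K A) [GradedAlgebra 𝒜]
    {N : Type u} [AddCommGroup N] [Module A N] (𝒩 : ℤ → AddSubgroup N) :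
    (i : ℕ) → ℤ → Submodule K (Fbar 𝒜 𝒩 i)
  | 0, j => strand 𝒜 𝒩 0 j
  | i + 1, j => strand 𝒜 𝒩 (i + 1) j ⊓ LinearMap.ker (dbar 𝒜 𝒩 i)

/-- The boundaries of homological degree `i` and internal degree `j` of `k ⊗_A F`. -/
def boundaries {A : Type u} [CommRing A] [Algebra K A] (𝒜 : ℕ → Submodule K A)
    [GradedAlgebra 𝒜] {N : Type u} [AddCommGroup N] [Module A N] (𝒩 : ℤ → AddSubgroup N)
    (i : ℕ) (j : ℤ) : Submodule K (Fbar 𝒜 𝒩 i) :=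
  (strand 𝒜 𝒩 (i + 1) j).map (dbar 𝒜 𝒩 i)

/-- `Tor_i^A(k, N)_j = H_i(k ⊗_A F)_j`. -/
abbrev Tor {A : Type u} [CommRing A] [Algebra K A] (𝒜 : ℕ → Submodule K A) [GradedAlgebra 𝒜]
    {N : Type u} [AddCommGroup N] [Module A N] (𝒩 : ℤ → AddSubgroup N) (i : ℕ) (j : ℤ) : Type u :=
  cycles 𝒜 𝒩 i j ⧸ (boundaries 𝒜 𝒩 i j).comap (cycles 𝒜 𝒩 i j).subtype

/-! ## Functoriality of Tor under change of rings -/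

/-- The `φ`-semilinear map of free modules that sends the basis element `b` to the basis
element `g b`. -/
def freeMap {A B : Type u} [CommRing A] [Algebra K A] [CommRing B] [Algebra K B]
    (φ : A →ₐ[K] B) {ι ι' : Type u} (g : ι → ι') : (ι →₀ A) →ₗ[K] (ι' →₀ B) :=
  Finsupp.lmapDomain B K g ∘ₗ Finsupp.mapRange.linearMap φ.toLinearMap

@[simp]
theorem freeMap_single {A B : Type u} [CommRing A] [Algebra K A] [CommRing B] [Algebra K B]
    (φ : A →ₐ[K] B) {ι ι' : Type u} (g : ι → ι') (b : ι) (a : A) :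
    freeMap φ g (Finsupp.single b a) = Finsupp.single (g b) (φ a) := by
  simp [freeMap]

theorem freeMap_smul {A B : Type u} [CommRing A] [Algebra K A] [CommRing B] [Algebra K B]
    (φ : A →ₐ[K] B) {ι ι' : Type u} (g : ι → ι') (a : A) (x : ι →₀ A) :
    freeMap φ g (a • x) = φ a • freeMap φ g x := by
  induction x using Finsupp.induction_linear with
  | zero => simp
  | add x y hx hy => rw [smul_add, map_add, map_add, smul_add, hx, hy]
  | single b c =>
    rw [Finsupp.smul_single, freeMap_single, freeMap_single, Finsupp.smul_single, smul_eq_mul,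
      smul_eq_mul, map_mul]

theorem map_mem_intPiece {A B : Type u} [CommRing A] [Algebra K A] [CommRing B] [Algebra K B]
    {𝒜 : ℕ → Submodule K A} {ℬ : ℕ → Submodule K B} [GradedAlgebra 𝒜] [GradedAlgebra ℬ]
    (φ : 𝒜 →ₐᵍ[K] ℬ) {j : ℤ} {a : A} (ha : a ∈ intPiece 𝒜 j) : φ a ∈ intPiece ℬ j := by
  unfold intPiece at ha ⊢
  split_ifs at ha ⊢
  · exact φ.map_mem ha
  · rw [(Submodule.mem_bot K).1 ha, map_zero]
    exact zero_mem _

theorem freeMap_mem_freePiece {A B : Type u} [CommRing A] [Algebra K A] [CommRing B]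
    [Algebra K B] {𝒜 : ℕ → Submodule K A} {ℬ : ℕ → Submodule K B} [GradedAlgebra 𝒜]
    [GradedAlgebra ℬ] (φ : 𝒜 →ₐᵍ[K] ℬ) {ι ι' : Type u} {deg : ι → ℤ} {deg' : ι' → ℤ} (g : ι → ι')
    (hg : ∀ b, deg' (g b) = deg b) {j : ℤ} {x : ι →₀ A} (hx : x ∈ freePiece 𝒜 deg j) :
    freeMap (φ : A →ₐ[K] B) g x ∈ freePiece ℬ deg' j := by
  classical
  rw [← Finsupp.sum_single x, Finsupp.sum, map_sum]
  refine Submodule.sum_mem _ fun b _ b' => ?_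
  rw [freeMap_single]
  by_cases h : g b = b'
  · subst h
    rw [Finsupp.single_eq_same, hg]
    exact map_mem_intPiece φ (hx b)
  · rw [Finsupp.single_eq_of_ne' h]
    exact zero_mem _

theorem map_irrelevant {A B : Type u} [CommRing A] [Algebra K A] [CommRing B] [Algebra K B]
    {𝒜 : ℕ → Submodule K A} {ℬ : ℕ → Submodule K B} [GradedAlgebra 𝒜] [GradedAlgebra ℬ]
    (φ : 𝒜 →ₐᵍ[K] ℬ) :
    (HomogeneousIdeal.irrelevant 𝒜).toIdeal ≤
      (HomogeneousIdeal.irrelevant ℬ).toIdeal.comap ((φ : A →ₐ[K] B) : A →+* B) := by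
  rw [HomogeneousIdeal.toIdeal_irrelevant_le]
  intro i hi a ha
  exact HomogeneousIdeal.mem_irrelevant_of_mem ℬ hi (φ.map_mem ha)

theorem freeMap_plus {A B : Type u} [CommRing A] [Algebra K A] [CommRing B]
    [Algebra K B] {𝒜 : ℕ → Submodule K A} {ℬ : ℕ → Submodule K B} [GradedAlgebra 𝒜]
    [GradedAlgebra ℬ] (φ : 𝒜 →ₐᵍ[K] ℬ) {ι ι' : Type u} (g : ι → ι') :
    plus 𝒜 ι ≤ (plus ℬ ι').comap (freeMap (φ : A →ₐ[K] B) g) := by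
  intro x hx
  change x ∈ (HomogeneousIdeal.irrelevant 𝒜).toIdeal • (⊤ : Submodule A (ι →₀ A)) at hx
  change freeMap (φ : A →ₐ[K] B) g x ∈
    (HomogeneousIdeal.irrelevant ℬ).toIdeal • (⊤ : Submodule B (ι' →₀ B))
  induction hx using Submodule.smul_induction_on' with
  | smul a ha y _ =>
    rw [freeMap_smul]
    exact Submodule.smul_mem_smul (map_irrelevant φ ha) Submodule.mem_top
  | add x _ y _ hx hy =>
    rw [map_add]
    exact add_mem hx hy

/-- A map of stages over `φ`. -/
structure StageHom {A B : Type u} [CommRing A] [Algebra K A] [CommRing B] [Algebra K B]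
    (φ : A →ₐ[K] B) (S : Stage A) (T : Stage B) where
  g : S.ι → T.ι
  deg_eq : ∀ b, T.deg (g b) = S.deg b
  map_rel : ∀ x ∈ S.rel, freeMap φ g x ∈ T.rel

/-- The map that a map of stages induces on the homogeneous elements of `rel`. -/
def StageHom.gen {A B : Type u} [CommRing A] [Algebra K A] [CommRing B] [Algebra K B]
    {𝒜 : ℕ → Submodule K A} {ℬ : ℕ → Submodule K B} [GradedAlgebra 𝒜] [GradedAlgebra ℬ]
    (φ : 𝒜 →ₐᵍ[K] ℬ) {S : Stage A} {T : Stage B} (h : StageHom (φ : A →ₐ[K] B) S T)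
    (b : S.Gen 𝒜) : T.Gen ℬ :=
  ⟨b.1, freeMap (φ : A →ₐ[K] B) h.g b.2.1, h.map_rel _ b.2.2.1,
    freeMap_mem_freePiece φ h.g h.deg_eq b.2.2.2⟩

theorem StageHom.diff_freeMap {A B : Type u} [CommRing A] [Algebra K A] [CommRing B]
    [Algebra K B] {𝒜 : ℕ → Submodule K A} {ℬ : ℕ → Submodule K B} [GradedAlgebra 𝒜]
    [GradedAlgebra ℬ] (φ : 𝒜 →ₐᵍ[K] ℬ) {S : Stage A} {T : Stage B}
    (h : StageHom (φ : A →ₐ[K] B) S T) (x : S.Gen 𝒜 →₀ A) :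
    T.diff ℬ (freeMap (φ : A →ₐ[K] B) (h.gen φ) x) =
      freeMap (φ : A →ₐ[K] B) h.g (S.diff 𝒜 x) := by
  induction x using Finsupp.induction_linear with
  | zero => simp
  | add x y hx hy => simp only [map_add, hx, hy]
  | single b a =>
    rw [freeMap_single, Stage.diff, Stage.diff, Finsupp.linearCombination_single,
      Finsupp.linearCombination_single, freeMap_smul]
    rfl

def StageHom.next {A B : Type u} [CommRing A] [Algebra K A] [CommRing B] [Algebra K B]
    {𝒜 : ℕ → Submodule K A} {ℬ : ℕ → Submodule K B} [GradedAlgebra 𝒜] [GradedAlgebra ℬ]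
    (φ : 𝒜 →ₐᵍ[K] ℬ) {S : Stage A} {T : Stage B} (h : StageHom (φ : A →ₐ[K] B) S T) :
    StageHom (φ : A →ₐ[K] B) (S.next 𝒜) (T.next ℬ) where
  g := h.gen φ
  deg_eq _ := rfl
  map_rel x hx := by
    have hx' : S.diff 𝒜 x = 0 := hx
    exact (h.diff_freeMap φ x).trans (by rw [hx', map_zero])

/-- A homomorphism of degree zero from a graded `A`-module to a graded `B`-module that is linear
over the homomorphism `φ : A → B` of graded algebras. -/
structure GradedHomOver {A B : Type u} [CommRing A] [Algebra K A] [CommRing B] [Algebra K B]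
    {𝒜 : ℕ → Submodule K A} {ℬ : ℕ → Submodule K B} [GradedAlgebra 𝒜] [GradedAlgebra ℬ]
    (φ : 𝒜 →ₐᵍ[K] ℬ) {N N' : Type u} [AddCommGroup N] [Module A N] [AddCommGroup N'] [Module B N']
    (𝒩 : ℤ → AddSubgroup N) (𝒩' : ℤ → AddSubgroup N') where
  toFun : N →+ N'
  map_smul : ∀ (a : A) (n : N), toFun (a • n) = φ a • toFun n
  map_mem : ∀ (j : ℤ) (n : N), n ∈ 𝒩 j → toFun n ∈ 𝒩' j

section Functoriality

variable {A B : Type u} [CommRing A] [Algebra K A] [CommRing B] [Algebra K B]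
  {𝒜 : ℕ → Submodule K A} {ℬ : ℕ → Submodule K B} [GradedAlgebra 𝒜] [GradedAlgebra ℬ]
  (φ : 𝒜 →ₐᵍ[K] ℬ) {N N' : Type u} [AddCommGroup N] [Module A N] [AddCommGroup N'] [Module B N']
  {𝒩 : ℤ → AddSubgroup N} {𝒩' : ℤ → AddSubgroup N'} (f : GradedHomOver φ 𝒩 𝒩')

theorem augmentation_freeMap (x : (Σ j : ℤ, 𝒩 j) →₀ A) :
    augmentation B 𝒩' (freeMap (φ : A →ₐ[K] B)
        (fun b : (Σ j : ℤ, 𝒩 j) =>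
          (⟨b.1, f.toFun b.2, f.map_mem b.1 _ b.2.2⟩ : Σ j : ℤ, 𝒩' j)) x) =
      f.toFun (augmentation A 𝒩 x) := by
  induction x using Finsupp.induction_linear with
  | zero => simp
  | add x y hx hy => simp only [map_add, hx, hy]
  | single b a =>
    rw [freeMap_single, augmentation, augmentation, Finsupp.linearCombination_single,
      Finsupp.linearCombination_single, f.map_smul]
    rfl

/-- The map of standard resolutions over `f : N → N'`, on bases. -/
def stageHom : (n : ℕ) → StageHom (φ : A →ₐ[K] B) (stage 𝒜 𝒩 n) (stage ℬ 𝒩' n)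
  | 0 =>
    { g := fun b : (Σ j : ℤ, 𝒩 j) => ⟨b.1, f.toFun b.2, f.map_mem b.1 _ b.2.2⟩
      deg_eq := fun _ => rfl
      map_rel := fun x hx => by
        have hx' : augmentation A 𝒩 x = 0 := hx
        exact (augmentation_freeMap φ f x).trans (by rw [hx', map_zero]) }
  | n + 1 => (stageHom n).next φ

/-- The chain map of standard resolutions that lifts `f : N → N'`. -/
def chainMap (n : ℕ) : F 𝒜 𝒩 n →ₗ[K] F ℬ 𝒩' n :=
  freeMap (φ : A →ₐ[K] B) (stageHom φ f n).g

theorem d_chainMap (n : ℕ) (x : F 𝒜 𝒩 (n + 1)) :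
    d ℬ 𝒩' n (chainMap φ f (n + 1) x) = chainMap φ f n (d 𝒜 𝒩 n x) :=
  (stageHom φ f n).diff_freeMap φ x

/-- The induced map `k ⊗_A F_n → k ⊗_B F'_n`. -/
def chainMapBar (n : ℕ) : Fbar 𝒜 𝒩 n →ₗ[K] Fbar ℬ 𝒩' n :=
  Submodule.mapQ _ _ (chainMap φ f n) (freeMap_plus φ _)

theorem dbar_chainMapBar (n : ℕ) (x : Fbar 𝒜 𝒩 (n + 1)) :
    dbar ℬ 𝒩' n (chainMapBar φ f (n + 1) x) = chainMapBar φ f n (dbar 𝒜 𝒩 n x) := by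
  obtain ⟨y, rfl⟩ := Submodule.mkQ_surjective _ x
  exact congrArg (Submodule.mkQ _) (d_chainMap φ f n y)

theorem chainMapBar_strand (n : ℕ) (j : ℤ) :
    strand 𝒜 𝒩 n j ≤ (strand ℬ 𝒩' n j).comap (chainMapBar φ f n) := by
  rintro _ ⟨y, hy, rfl⟩
  exact ⟨chainMap φ f n y,
    freeMap_mem_freePiece φ _ (stageHom φ f n).deg_eq hy, rfl⟩

theorem chainMapBar_cycles (i : ℕ) (j : ℤ) :
    ∀ x ∈ cycles 𝒜 𝒩 i j, chainMapBar φ f i x ∈ cycles ℬ 𝒩' i j := by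
  intro x hx
  cases i with
  | zero => exact chainMapBar_strand φ f 0 j hx
  | succ i =>
    refine ⟨chainMapBar_strand φ f _ j hx.1, ?_⟩
    have hx' : dbar 𝒜 𝒩 i x = 0 := hx.2
    exact (dbar_chainMapBar φ f i x).trans (by rw [hx', map_zero])

theorem chainMapBar_boundaries (i : ℕ) (j : ℤ) :
    ∀ x ∈ boundaries 𝒜 𝒩 i j, chainMapBar φ f i x ∈ boundaries ℬ 𝒩' i j := by
  rintro _ ⟨y, hy, rfl⟩
  exact ⟨chainMapBar φ f (i + 1) y, chainMapBar_strand φ f _ j hy, dbar_chainMapBar φ f i y⟩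

/-- `Tor_i^φ(k, f)_j : Tor_i^A(k, N)_j → Tor_i^B(k, N')_j`. -/
def torMap (i : ℕ) (j : ℤ) : Tor 𝒜 𝒩 i j →ₗ[K] Tor ℬ 𝒩' i j :=
  Submodule.mapQ _ _ ((chainMapBar φ f i).restrict (chainMapBar_cycles φ f i j))
    fun x hx => chainMapBar_boundaries φ f i j x.1 hx

end Functoriality

/-! ## The residue field, Koszul algebras and modules, small homomorphisms -/

/-- `k = A / A_+`. -/
abbrev Residue {A : Type u} [CommRing A] [Algebra K A] (𝒜 : ℕ → Submodule K A)
    [GradedAlgebra 𝒜] : Type u :=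
  A ⧸ (HomogeneousIdeal.irrelevant 𝒜).toIdeal

/-- The grading of `k`, which is concentrated in degree `0`. -/
def residuePiece {A : Type u} [CommRing A] [Algebra K A] (𝒜 : ℕ → Submodule K A)
    [GradedAlgebra 𝒜] (j : ℤ) : AddSubgroup (Residue 𝒜) :=
  if j = 0 then ⊤ else ⊥

/-- The canonical homomorphism `A / A_+ → B / B_+` over `φ : A → B`. -/
def residueHom {A B : Type u} [CommRing A] [Algebra K A] [CommRing B] [Algebra K B]
    {𝒜 : ℕ → Submodule K A} {ℬ : ℕ → Submodule K B} [GradedAlgebra 𝒜] [GradedAlgebra ℬ]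
    (φ : 𝒜 →ₐᵍ[K] ℬ) : GradedHomOver φ (residuePiece 𝒜) (residuePiece ℬ) where
  toFun := (Ideal.quotientMap _ ((φ : A →ₐ[K] B) : A →+* B) (map_irrelevant φ)).toAddMonoidHom
  map_smul a n := by
    obtain ⟨x, rfl⟩ := Ideal.Quotient.mk_surjective n
    change Ideal.Quotient.mk _ (φ (a * x)) = Ideal.Quotient.mk _ (φ a * φ x)
    rw [map_mul]
  map_mem j n hn := by
    unfold residuePiece at hn ⊢
    split_ifs at hn ⊢
    · trivial
    · rw [(AddSubgroup.mem_bot).1 hn, map_zero]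
      exact zero_mem _

/-- The identity of `M`, as a homomorphism over `φ` from `M` with its structure of `A`-module
restricted along `φ` to the `B`-module `M`. -/
def idOver {A B : Type u} [CommRing A] [Algebra K A] [CommRing B] [Algebra K B]
    {𝒜 : ℕ → Submodule K A} {ℬ : ℕ → Submodule K B} [GradedAlgebra 𝒜] [GradedAlgebra ℬ]
    (φ : 𝒜 →ₐᵍ[K] ℬ) {M : Type u} [AddCommGroup M] [Module A M] [Module B M]
    (hM : ∀ (a : A) (m : M), a • m = φ a • m) (ℳ : ℤ → AddSubgroup M) :
    GradedHomOver φ (N := M) (N' := M) ℳ ℳ where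
  toFun := AddMonoidHom.id M
  map_smul a m := hM a m
  map_mem _ _ hm := hm

/-- `φ` is small: `Tor_i^φ(k, k)_j` is injective for all `i` and `j`. -/
def IsSmall {A B : Type u} [CommRing A] [Algebra K A] [CommRing B] [Algebra K B]
    {𝒜 : ℕ → Submodule K A} {ℬ : ℕ → Submodule K B} [GradedAlgebra 𝒜] [GradedAlgebra ℬ]
    (φ : 𝒜 →ₐᵍ[K] ℬ) : Prop :=
  ∀ (i : ℕ) (j : ℤ), Function.Injective (torMap φ (residueHom φ) i j)

/-- `sup {j | Tor_i^A(k, N)_j ≠ 0}`, which is `-∞` if `Tor_i^A(k, N) = 0`. -/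
def topDegree {A : Type u} [CommRing A] [Algebra K A] (𝒜 : ℕ → Submodule K A) [GradedAlgebra 𝒜]
    {N : Type u} [AddCommGroup N] [Module A N] (𝒩 : ℤ → AddSubgroup N) (i : ℕ) : EReal :=
  sSup {e : EReal | ∃ j : ℤ, Nontrivial (Tor 𝒜 𝒩 i j) ∧ e = ((j : ℝ) : EReal)}

/-- The Castelnuovo-Mumford regularity of `N` over `A`. -/
def regularity {A : Type u} [CommRing A] [Algebra K A] (𝒜 : ℕ → Submodule K A) [GradedAlgebra 𝒜]
    {N : Type u} [AddCommGroup N] [Module A N] (𝒩 : ℤ → AddSubgroup N) : EReal :=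
  ⨆ i : ℕ, topDegree 𝒜 𝒩 i - ((i : ℝ) : EReal)

/-- The graded algebra `A` is Koszul: the regularity of `k` over `A` is `0`. -/
def IsKoszulAlgebra {A : Type u} [CommRing A] [Algebra K A] (𝒜 : ℕ → Submodule K A)
    [GradedAlgebra 𝒜] : Prop :=
  regularity 𝒜 (residuePiece 𝒜) = 0

/-- The graded module `N` is Koszul over `A`: `Tor_i^A(k, N)_j = 0` unless `i = j`. -/
def IsKoszulModule {A : Type u} [CommRing A] [Algebra K A] (𝒜 : ℕ → Submodule K A)
    [GradedAlgebra 𝒜] {N : Type u} [AddCommGroup N] [Module A N] (𝒩 : ℤ → AddSubgroup N) : Prop :=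
  ∀ (i : ℕ) (j : ℤ), (i : ℤ) ≠ j → Subsingleton (Tor 𝒜 𝒩 i j)

/-- `A` is a standard graded `K`-algebra: `A_0 = K`, and `A` is generated as a `K`-algebra by
`A_1`, which has finite dimension. -/
structure IsStandardGraded {A : Type u} [CommRing A] [Algebra K A] (𝒜 : ℕ → Submodule K A) :
    Prop where
  nontrivial : Nontrivial A
  zero_eq : ∀ a ∈ 𝒜 0, ∃ c : K, algebraMap K A c = a
  finite : Module.Finite K (𝒜 1)
  adjoin_eq : Algebra.adjoin K (𝒜 1 : Set A) = ⊤

end KoszulTor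

end

noncomputable section

namespace KoszulTor

variable {K : Type v} [Field K]

/-! ## Complexes of graded free modules with coefficients -/

/-! Let `N` be the module that is resolved (`k` in (1), `M` in (2)), and let `C` and `D` be its
standard resolutions over `Q` and `R`. The map in question is the map on homology of `C` and `D`
with coefficients in `k`. The proof fixes `C` and `D` and varies the coefficients: for a graded
`Q`-module `Y` and `X = Y/JY` it studies `Tor^Q_n(Y, N)_j → Tor^R_n(X, N)_j`.

The core is `torMap_injective`: if `Tor^Q_n(k, N)_j = 0` for all `j < n`, then the map is injective
for `j ≤ n`. For `N = k` this vanishing is a degree count (`resolution_vanishes_of_low`); for `N =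
M` it is part of the Koszul hypothesis. In the remaining degrees the Koszul hypothesis makes the
source zero.

The coefficients are replaced by syzygies. Let `Y` live in degrees at least `q`, let `P → Y` be the
free cover on a homogeneous `K`-basis, and let `Y'` be its kernel, which lives in degrees at least
`q + 1`. Put `X' = Y'/JY'`, `P' = P/JP` and `B = Ker(P' → X)`. Then `X'` maps onto `B` with kernel
`ℋ = (Y' ∩ JP)/JY'`. As `J` starts in degree 2, `ℋ` starts in degree `q + 2`. Moreover `R_+` kills
`ℋ`: each `a` in `Q_+` acts on `k` as zero, and the property that `a` acts through a free module
passes to syzygies, by a map `u : P → Y'` that restricts to multiplication by `a` on `Y'`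
(`IsLinear.exists_section`). Hence `a (Y' ∩ JP) = u (Y' ∩ JP) ⊆ JY'` (`exists_syzygy`).

So the Tor of `ℋ` is a sum of shifts of `Tor^R(k, N)`. Once the latter vanishes below the diagonal,
`Tor^R_n(ℋ, N)_j = 0` for `j < n + q + 2`, and injectivity for `Y'` in homological degree `n` gives
injectivity for `Y` in degree `n + 1` (`Comparison.injectiveAt_succ`). That vanishing over `R` is
not given. It is proved in the same strong induction, which therefore treats all `Y` at once
(`Comparison.vanishes_and_injectiveAt`). -/

/-- The component of degree `j` of `⨁ b, X(-deg b)`. -/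
def strandOf {ι X : Type*} [AddCommGroup X] (deg : ι → ℤ) (𝒳 : ℤ → AddSubgroup X)
    (j : ℤ) : AddSubgroup (ι →₀ X) where
  carrier := {x | ∀ b, x b ∈ 𝒳 (j - deg b)}
  add_mem' hx hy b := add_mem (hx b) (hy b)
  zero_mem' _ := zero_mem _
  neg_mem' hx b := neg_mem (hx b)

/-- The additive map that sends `y` at `b` to `f y` at `g b`. -/
def push {ι ι' Y X : Type*} [AddCommGroup Y] [AddCommGroup X] (g : ι → ι')
    (f : Y →+ X) : (ι →₀ Y) →+ (ι' →₀ X) :=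
  Finsupp.liftAddHom fun b => (Finsupp.singleAddHom (g b)).comp f

/-- The matrix with columns `e`, acting on vectors with coefficients in a module. -/
def act {A : Type u} [CommRing A] {X ι ι' : Type*} [AddCommGroup X] [Module A X]
    (e : ι → ι' →₀ A) : (ι →₀ X) →+ (ι' →₀ X) :=
  Finsupp.liftAddHom fun b =>
    { toFun := fun y => push id (LinearMap.toSpanSingleton A X y).toAddMonoidHom (e b)
      map_zero' := by
        induction e b using Finsupp.induction_linear with
        | zero => simp
        | add x y hx hy => rw [map_add, hx, hy, add_zero]
        | single b a => simp [push]
      map_add' := fun y z => by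
        induction e b using Finsupp.induction_linear with
        | zero => simp
        | add x x' hx hy =>
          rw [map_add, hx, hy, map_add, map_add]
          abel
        | single b a => simp [push] }

/-! ### Additive maps and matrices on finitely supported vectors. -/

section PushAct

variable {ι ι' ι'' X Y Z : Type*} [AddCommGroup X] [AddCommGroup Y] [AddCommGroup Z]

@[simp]
theorem push_single (g : ι → ι') (f : Y →+ X) (b : ι) (y : Y) :
    push g f (Finsupp.single b y) = Finsupp.single (g b) (f y) := by
  simp [push]

theorem push_id_apply (f : Y →+ X) (x : ι →₀ Y) (b : ι) : push id f x b = f (x b) := by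
  classical
  induction x using Finsupp.induction_linear with
  | zero => simp
  | add x y hx hy => simp [hx, hy]
  | single c a =>
    rw [push_single, id, Finsupp.single_apply, Finsupp.single_apply]
    split_ifs <;> simp

theorem push_apply_of_injective {g : ι → ι'} (hg : Function.Injective g) (f : Y →+ X)
    (x : ι →₀ Y) (b : ι) : push g f x (g b) = f (x b) := by
  classical
  induction x using Finsupp.induction_linear with
  | zero => simp
  | add x y hx hy => simp [hx, hy]
  | single c a =>
    rw [push_single, Finsupp.single_apply, Finsupp.single_apply, hg.eq_iff]
    split_ifs <;> simp

theorem push_push (g : ι → ι') (g' : ι' → ι'') (f : Y →+ X) (f' : X →+ Z) (x : ι →₀ Y) :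
    push g' f' (push g f x) = push (g' ∘ g) (f'.comp f) x := by
  induction x using Finsupp.induction_linear with
  | zero => simp
  | add x y hx hy => simp only [map_add, hx, hy]
  | single c a => simp

theorem push_mem_strandOf {deg : ι → ℤ} {deg' : ι' → ℤ} {g : ι → ι'}
    (hg : ∀ b, deg' (g b) = deg b) {𝒴 : ℤ → AddSubgroup Y} {𝒳 : ℤ → AddSubgroup X} {f : Y →+ X}
    (hf : ∀ j y, y ∈ 𝒴 j → f y ∈ 𝒳 j) {j : ℤ} {x : ι →₀ Y} (hx : x ∈ strandOf deg 𝒴 j) :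
    push g f x ∈ strandOf deg' 𝒳 j := by
  classical
  rw [← Finsupp.sum_single x, Finsupp.sum, map_sum]
  refine AddSubgroup.sum_mem _ fun b _ b' => ?_
  rw [push_single]
  by_cases h : g b = b'
  · subst h
    rw [Finsupp.single_eq_same, hg]
    exact hf _ _ (hx b)
  · rw [Finsupp.single_eq_of_ne' h]
    exact zero_mem _

theorem single_mem_strandOf {deg : ι → ℤ} {𝒳 : ℤ → AddSubgroup X} {j : ℤ} {b : ι} {x : X}
    (hx : x ∈ 𝒳 (j - deg b)) : Finsupp.single b x ∈ strandOf deg 𝒳 j := by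
  classical
  intro b'
  rw [Finsupp.single_apply]
  split_ifs with h
  · rwa [← h]
  · exact zero_mem _

/-- A surjective map lifts elements of strands. -/
theorem exists_push_eq {deg : ι → ℤ} {deg' : ι' → ℤ} {g : ι → ι'}
    (hg : ∀ b, deg' (g b) = deg b) (hgs : Function.Surjective g) {𝒴 : ℤ → AddSubgroup Y}
    {𝒳 : ℤ → AddSubgroup X} {f : Y →+ X} (hf : ∀ j, ∀ x ∈ 𝒳 j, ∃ y ∈ 𝒴 j, f y = x) {j : ℤ}
    {x : ι' →₀ X} (hx : x ∈ strandOf deg' 𝒳 j) :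
    ∃ y ∈ strandOf deg 𝒴 j, push g f y = x := by
  classical
  choose s hs using hgs
  choose p hp hpx using fun b => hf _ _ (hx b)
  refine ⟨∑ b ∈ x.support, Finsupp.single (s b) (p b), AddSubgroup.sum_mem _ fun b _ => ?_, ?_⟩
  · apply single_mem_strandOf
    rw [← hg, hs]
    exact hp b
  · rw [map_sum]
    conv_rhs => rw [← Finsupp.sum_single x]
    exact Finset.sum_congr rfl fun b _ => by rw [push_single, hs, hpx]

variable {A B : Type u} [CommRing A] [CommRing B] [Module A X] [Module A Y] [Module B Z]

theorem act_single (e : ι → ι' →₀ A) (b : ι) (y : X) :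
    act e (Finsupp.single b y) = push id (LinearMap.toSpanSingleton A X y).toAddMonoidHom (e b) :=
  Finsupp.liftAddHom_apply_single _ _ _

/-- Semilinear maps commute with the action of compatible matrices. -/
theorem act_push (σ : A →+* B) {ι₁ ι₁' : Type*} (e : ι → ι' →₀ A) (e' : ι₁ → ι₁' →₀ B)
    (g : ι → ι₁) (g' : ι' → ι₁') (hg : ∀ b, e' (g b) = push g' σ.toAddMonoidHom (e b))
    (f : Y →+ Z) (hf : ∀ (a : A) (y : Y), f (a • y) = σ a • f y) (x : ι →₀ Y) :
    act e' (push g f x) = push g' f (act e x) := by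
  induction x using Finsupp.induction_linear with
  | zero => simp
  | add x y hx hy => simp only [map_add, hx, hy]
  | single b y =>
    rw [push_single, act_single, act_single, hg, push_push, push_push]
    congr 1
    ext a
    simp [hf]

theorem act_push_id (e : ι → ι' →₀ A) (f : Y →ₗ[A] X) (x : ι →₀ Y) :
    act e (push id f.toAddMonoidHom x) = push id f.toAddMonoidHom (act e x) := by
  refine act_push (RingHom.id A) e e id id (fun b => ?_) f.toAddMonoidHom (fun a y => ?_) x
  · ext c
    rw [push_id_apply]
    rfl
  · simp

theorem act_self (e : ι → ι' →₀ A) (x : ι →₀ A) :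
    act e x = Finsupp.linearCombination A e x := by
  induction x using Finsupp.induction_linear with
  | zero => simp
  | add x y hx hy => simp only [map_add, hx, hy]
  | single b y =>
    rw [act_single, Finsupp.linearCombination_single]
    ext c
    rw [push_id_apply]
    simp [mul_comm]

/-- Products of matrices act as zero if they do so on the ring. -/
theorem act_act (e : ι → ι' →₀ A) (e' : ι'' → ι →₀ A) (h : ∀ b, act (X := A) e (e' b) = 0)
    (x : ι'' →₀ X) : act e (act e' x) = 0 := by
  induction x using Finsupp.induction_linear with
  | zero => simp
  | add x y hx hy => simp only [map_add, hx, hy, add_zero]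
  | single b y => rw [act_single, act_push_id, h, map_zero]

end PushAct

/-- Multiplication is compatible with the gradings. -/
def GradedSMul {A : Type u} [CommRing A] [Algebra K A] (𝒜 : ℕ → Submodule K A) {X : Type u}
    [AddCommGroup X] [Module A X] (𝒳 : ℤ → AddSubgroup X) : Prop :=
  ∀ (i : ℕ) (j : ℤ) (a : A) (x : X), a ∈ 𝒜 i → x ∈ 𝒳 j → a • x ∈ 𝒳 ((i : ℤ) + j)

theorem act_mem_strandOf {A : Type u} [CommRing A] [Algebra K A] {𝒜 : ℕ → Submodule K A}
    {X : Type u} [AddCommGroup X] [Module A X] {𝒳 : ℤ → AddSubgroup X} (h𝒳 : GradedSMul 𝒜 𝒳)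
    {ι ι' : Type u} {deg : ι → ℤ} {deg' : ι' → ℤ} {e : ι → ι' →₀ A}
    (he : ∀ b, e b ∈ freePiece 𝒜 deg' (deg b)) {j : ℤ} {x : ι →₀ X} (hx : x ∈ strandOf deg 𝒳 j) :
    act e x ∈ strandOf deg' 𝒳 j := by
  classical
  rw [← Finsupp.sum_single x, Finsupp.sum, map_sum]
  refine AddSubgroup.sum_mem _ fun b _ b' => ?_
  rw [act_single, push_id_apply]
  have h1 := he b b'
  have h2 := hx b
  simp only [LinearMap.toAddMonoidHom_coe, LinearMap.toSpanSingleton_apply]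
  unfold intPiece at h1
  split_ifs at h1 with h
  · have := h𝒳 _ _ _ _ h1 h2
    convert this using 2
    omega
  · rw [(Submodule.mem_bot K).1 h1, zero_smul]
    exact zero_mem _

/-- A complex of graded free modules with bases `ι n`, with differential given by matrices. -/
structure FreeComplex {A : Type u} [CommRing A] [Algebra K A] (𝒜 : ℕ → Submodule K A) where
  ι : ℕ → Type u
  deg : ∀ n, ι n → ℤ
  e : ∀ n, ι (n + 1) → ι n →₀ A
  e_mem : ∀ n b, e n b ∈ freePiece 𝒜 (deg n) (deg (n + 1) b)
  act_e : ∀ n b, act (X := A) (e n) (e (n + 1) b) = 0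

namespace FreeComplex

variable {A : Type u} [CommRing A] [Algebra K A] {𝒜 : ℕ → Submodule K A} (C : FreeComplex 𝒜)

/-- The cycles of the complex with coefficients in `X`. -/
def IsCycle {X : Type u} [AddCommGroup X] [Module A X] : (n : ℕ) → (C.ι n →₀ X) → Prop
  | 0, _ => True
  | n + 1, z => act (C.e n) z = 0

/-- The homology with coefficients in `X` vanishes in homological degree `n` and internal
degree `j`. -/
def Vanishes {X : Type u} [AddCommGroup X] [Module A X] (𝒳 : ℤ → AddSubgroup X) (n : ℕ)
    (j : ℤ) : Prop :=
  ∀ z ∈ strandOf (C.deg n) 𝒳 j, C.IsCycle n z →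
    ∃ w ∈ strandOf (C.deg (n + 1)) 𝒳 j, act (C.e n) w = z

variable {X X₁ X₂ X₃ : Type u} [AddCommGroup X] [Module A X] [AddCommGroup X₁] [Module A X₁]
  [AddCommGroup X₂] [Module A X₂] [AddCommGroup X₃] [Module A X₃]

theorem isCycle_act (n : ℕ) (x : C.ι (n + 1) →₀ X) : C.IsCycle n (act (C.e n) x) := by
  cases n with
  | zero => trivial
  | succ n => exact act_act _ _ (C.act_e n) x

theorem IsCycle.sub {n : ℕ} {x y : C.ι n →₀ X} (hx : C.IsCycle n x) (hy : C.IsCycle n y) :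
    C.IsCycle n (x - y) := by
  cases n with
  | zero => trivial
  | succ n =>
    have hx' : act (C.e n) x = 0 := hx
    have hy' : act (C.e n) y = 0 := hy
    change act (C.e n) (x - y) = 0
    rw [map_sub, hx', hy', sub_zero]

theorem IsCycle.push (f : X₁ →ₗ[A] X₂) {n : ℕ} {x : C.ι n →₀ X₁} (hx : C.IsCycle n x) :
    C.IsCycle n (push id f.toAddMonoidHom x) := by
  cases n with
  | zero => trivial
  | succ n =>
    have hx' : act (C.e n) x = 0 := hx
    change act (C.e n) _ = 0
    rw [act_push_id, hx', map_zero]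

end FreeComplex

/-- `0 → X₁ → X₂ → X₃ → 0` is exact in each degree. -/
structure StrandExact {A : Type u} [CommRing A] {X₁ X₂ X₃ : Type u} [AddCommGroup X₁]
    [Module A X₁] [AddCommGroup X₂] [Module A X₂] [AddCommGroup X₃] [Module A X₃]
    (f : X₁ →ₗ[A] X₂) (g : X₂ →ₗ[A] X₃) (𝒳₁ : ℤ → AddSubgroup X₁) (𝒳₂ : ℤ → AddSubgroup X₂)
    (𝒳₃ : ℤ → AddSubgroup X₃) : Prop where
  injective : Function.Injective f
  f_mem : ∀ j, ∀ x ∈ 𝒳₁ j, f x ∈ 𝒳₂ j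
  g_mem : ∀ j, ∀ x ∈ 𝒳₂ j, g x ∈ 𝒳₃ j
  surj : ∀ j, ∀ x ∈ 𝒳₃ j, ∃ y ∈ 𝒳₂ j, g y = x
  ker : ∀ j, ∀ y ∈ 𝒳₂ j, g y = 0 → ∃ x ∈ 𝒳₁ j, f x = y
  comp : ∀ x, g (f x) = 0

/-! ### Pieces of the long exact homology sequence in the coefficients. -/

namespace StrandExact

variable {A : Type u} [CommRing A] {X₁ X₂ X₃ : Type u} [AddCommGroup X₁]
  [Module A X₁] [AddCommGroup X₂] [Module A X₂] [AddCommGroup X₃] [Module A X₃]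
  {f : X₁ →ₗ[A] X₂} {g : X₂ →ₗ[A] X₃} {𝒳₁ : ℤ → AddSubgroup X₁} {𝒳₂ : ℤ → AddSubgroup X₂}
  {𝒳₃ : ℤ → AddSubgroup X₃} {ι : Type u} {deg : ι → ℤ} {j : ℤ}

theorem push_injective (h : StrandExact f g 𝒳₁ 𝒳₂ 𝒳₃) {x y : ι →₀ X₁}
    (hxy : push id f.toAddMonoidHom x = push id f.toAddMonoidHom y) : x = y := by
  ext b
  have := DFunLike.congr_fun hxy b
  rw [push_id_apply, push_id_apply] at this
  exact h.injective this

theorem push_f_mem (h : StrandExact f g 𝒳₁ 𝒳₂ 𝒳₃) {x : ι →₀ X₁} (hx : x ∈ strandOf deg 𝒳₁ j) :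
    push id f.toAddMonoidHom x ∈ strandOf deg 𝒳₂ j :=
  push_mem_strandOf (fun _ => rfl) h.f_mem hx

theorem push_g_mem (h : StrandExact f g 𝒳₁ 𝒳₂ 𝒳₃) {x : ι →₀ X₂} (hx : x ∈ strandOf deg 𝒳₂ j) :
    push id g.toAddMonoidHom x ∈ strandOf deg 𝒳₃ j :=
  push_mem_strandOf (fun _ => rfl) h.g_mem hx

theorem exists_push_g (h : StrandExact f g 𝒳₁ 𝒳₂ 𝒳₃) {x : ι →₀ X₃} (hx : x ∈ strandOf deg 𝒳₃ j) :
    ∃ y ∈ strandOf deg 𝒳₂ j, push id g.toAddMonoidHom y = x :=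
  exists_push_eq (fun _ => rfl) Function.surjective_id h.surj hx

theorem exists_push_f (h : StrandExact f g 𝒳₁ 𝒳₂ 𝒳₃) {y : ι →₀ X₂} (hy : y ∈ strandOf deg 𝒳₂ j)
    (hy0 : push id g.toAddMonoidHom y = 0) :
    ∃ x ∈ strandOf deg 𝒳₁ j, push id f.toAddMonoidHom x = y := by
  have hy' : y ∈ strandOf deg (fun i => 𝒳₂ i ⊓ g.toAddMonoidHom.ker) j := by
    intro b
    refine ⟨hy b, ?_⟩
    have := DFunLike.congr_fun hy0 b
    rwa [push_id_apply] at this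
  exact exists_push_eq (𝒳 := fun i => 𝒳₂ i ⊓ g.toAddMonoidHom.ker) (fun _ => rfl)
    Function.surjective_id (fun i x hx => h.ker i x hx.1 hx.2) hy'

theorem push_comp (h : StrandExact f g 𝒳₁ 𝒳₂ 𝒳₃) (x : ι →₀ X₁) :
    push id g.toAddMonoidHom (push id f.toAddMonoidHom x) = 0 := by
  ext b
  rw [push_id_apply, push_id_apply]
  exact h.comp _

theorem isCycle_of_push [Algebra K A] {𝒜 : ℕ → Submodule K A} (C : FreeComplex 𝒜)
    (h : StrandExact f g 𝒳₁ 𝒳₂ 𝒳₃) {n : ℕ} {x : C.ι n →₀ X₁}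
    (hx : C.IsCycle n (push id f.toAddMonoidHom x)) : C.IsCycle n x := by
  cases n with
  | zero => trivial
  | succ n =>
    have hx' : act (C.e n) (push id f.toAddMonoidHom x) = 0 := hx
    refine h.push_injective ?_
    rw [← act_push_id, hx', map_zero]

variable [Algebra K A] {𝒜 : ℕ → Submodule K A} (C : FreeComplex 𝒜)

/-- Exactness of `H_{n+1}(X₂) → H_{n+1}(X₃) → H_n(X₁)` in one internal degree. -/
theorem vanishes_right (h : StrandExact f g 𝒳₁ 𝒳₂ 𝒳₃) (h₂ : GradedSMul 𝒜 𝒳₂) {n : ℕ}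
    (H₂ : C.Vanishes 𝒳₂ (n + 1) j) (H₁ : C.Vanishes 𝒳₁ n j) : C.Vanishes 𝒳₃ (n + 1) j := by
  intro z hz hzc
  have hzc' : act (C.e n) z = 0 := hzc
  obtain ⟨y, hy, rfl⟩ := h.exists_push_g hz
  obtain ⟨x, hx, hxy⟩ := h.exists_push_f (act_mem_strandOf h₂ (C.e_mem n) hy)
    (by rw [← act_push_id, hzc'])
  obtain ⟨w, hw, rfl⟩ := H₁ x hx (h.isCycle_of_push C (hxy ▸ C.isCycle_act n y))
  obtain ⟨t, ht, htw⟩ := H₂ (y - push id f.toAddMonoidHom w) (sub_mem hy (h.push_f_mem hw))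
    (by
      change act (C.e n) _ = 0
      rw [map_sub, act_push_id, hxy, sub_self])
  refine ⟨push id g.toAddMonoidHom t, h.push_g_mem ht, ?_⟩
  rw [act_push_id, htw, map_sub, h.push_comp, sub_zero]

/-- Exactness of `H_{n+1}(X₃) → H_n(X₁) → H_n(X₂)` in one internal degree. -/
theorem vanishes_left (h : StrandExact f g 𝒳₁ 𝒳₂ 𝒳₃) (h₂ : GradedSMul 𝒜 𝒳₂) {n : ℕ}
    (H₂ : C.Vanishes 𝒳₂ n j) (H₃ : C.Vanishes 𝒳₃ (n + 1) j) : C.Vanishes 𝒳₁ n j := by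
  intro z hz hzc
  obtain ⟨t, ht, htz⟩ := H₂ _ (h.push_f_mem hz) (hzc.push C f)
  obtain ⟨w, hw, hwt⟩ := H₃ _ (h.push_g_mem ht) (by
    change act (C.e n) _ = 0
    rw [act_push_id, htz, h.push_comp])
  obtain ⟨s, hs, rfl⟩ := h.exists_push_g hw
  obtain ⟨x, hx, hxt⟩ := h.exists_push_f
    (sub_mem ht (act_mem_strandOf h₂ (C.e_mem (n + 1)) hs))
    (by rw [map_sub, ← hwt, act_push_id, sub_self])
  refine ⟨x, hx, h.push_injective ?_⟩
  rw [← act_push_id, hxt, map_sub, htz, act_act _ _ (C.act_e n), sub_zero]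

end StrandExact

/-! ### Vanishing under isomorphisms and direct sums of coefficients. -/

namespace FreeComplex

variable {A : Type u} [CommRing A] [Algebra K A] {𝒜 : ℕ → Submodule K A} (C : FreeComplex 𝒜)
  {X₂ X₃ U : Type u} [AddCommGroup X₂] [Module A X₂] [AddCommGroup X₃] [Module A X₃]
  [AddCommGroup U] [Module A U]

/-- Bijectivity is needed only degree by degree, so `𝒳₃` need not be an internal grading of `X₃`. -/
theorem Vanishes.of_bijective {𝒳₂ : ℤ → AddSubgroup X₂} {𝒳₃ : ℤ → AddSubgroup X₃}
    (h₂ : GradedSMul 𝒜 𝒳₂) (g : X₂ →ₗ[A] X₃) (hg : ∀ j, ∀ x ∈ 𝒳₂ j, g x ∈ 𝒳₃ j)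
    (hs : ∀ j, ∀ x ∈ 𝒳₃ j, ∃ y ∈ 𝒳₂ j, g y = x) (hi : ∀ j, ∀ x ∈ 𝒳₂ j, g x = 0 → x = 0)
    {n : ℕ} {j : ℤ} (H : C.Vanishes 𝒳₂ n j) : C.Vanishes 𝒳₃ n j := by
  intro z hz hzc
  obtain ⟨y, hy, rfl⟩ := exists_push_eq (deg := C.deg n) (fun _ => rfl) Function.surjective_id
    (f := g.toAddMonoidHom) hs hz
  have hyc : C.IsCycle n y := by
    cases n with
    | zero => trivial
    | succ n =>
      have hzc' : act (C.e n) (push id g.toAddMonoidHom y) = 0 := hzc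
      rw [act_push_id] at hzc'
      change act (C.e n) y = 0
      ext b
      refine hi _ _ (act_mem_strandOf h₂ (C.e_mem n) hy b) ?_
      have := DFunLike.congr_fun hzc' b
      rwa [push_id_apply] at this
  obtain ⟨w, hw, rfl⟩ := H y hy hyc
  exact ⟨push id g.toAddMonoidHom w, push_mem_strandOf (fun _ => rfl) hg hw, act_push_id _ _ _⟩

/-- Vanishing of homology passes to direct sums of shifts. -/
theorem Vanishes.finsupp {𝒰 : ℤ → AddSubgroup U} {κ : Type u} (dg : κ → ℤ)
    {n : ℕ} {j : ℤ} (H : ∀ c, C.Vanishes 𝒰 n (j - dg c)) :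
    C.Vanishes (X := κ →₀ U) (strandOf dg 𝒰) n j := by
  classical
  intro z hz hzc
  have hz' : ∀ c, push id (Finsupp.lapply (R := A) c : (κ →₀ U) →ₗ[A] U).toAddMonoidHom z ∈
      strandOf (C.deg n) 𝒰 (j - dg c) := by
    intro c b
    rw [push_id_apply, sub_right_comm]
    exact hz b c
  choose w hw hwz using fun c => H c _ (hz' c) (hzc.push C _)
  -- Only finitely many summands `c` meet the coordinates of `z`; the lifts chosen for the others
  -- are discarded.
  refine ⟨∑ c ∈ z.support.biUnion (fun b => (z b).support),
    push id (Finsupp.lsingle (R := A) c : U →ₗ[A] (κ →₀ U)).toAddMonoidHom (w c),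
    AddSubgroup.sum_mem _ fun c _ b => ?_, ?_⟩
  · rw [push_id_apply]
    refine single_mem_strandOf ?_
    rw [sub_right_comm]
    exact hw c b
  · rw [map_sum]
    ext b c
    rw [Finsupp.finsetSum_apply, Finsupp.finsetSum_apply]
    have key : ∀ c', act (C.e n) (push id
        (Finsupp.lsingle (R := A) c' : U →ₗ[A] (κ →₀ U)).toAddMonoidHom (w c')) b c =
        if c' = c then z b c else 0 := by
      intro c'
      rw [act_push_id, hwz, push_id_apply, push_id_apply]
      simp only [LinearMap.toAddMonoidHom_coe, Finsupp.lsingle_apply, Finsupp.lapply_apply,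
        Finsupp.single_apply]
      split_ifs with h
      · rw [h]
      · rfl
    rw [Finset.sum_congr rfl fun c' _ => key c', Finset.sum_ite_eq']
    split_ifs with h
    · rfl
    · by_contra hne
      refine h (Finset.mem_biUnion.2 ⟨b, ?_, ?_⟩)
      · rw [Finsupp.mem_support_iff]
        rintro h0
        rw [h0] at hne
        exact hne rfl
      · rw [Finsupp.mem_support_iff]
        exact fun h0 => hne h0.symm

end FreeComplex

/-! ## Gradings, homogeneous bases and reductions -/

theorem isInternal_of_independent_of_closure {Y : Type u} [AddCommGroup Y]
    {𝒴 : ℤ → AddSubgroup Y}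
    (hi : ∀ (s : Finset ℤ) (y : ℤ → Y), (∀ j ∈ s, y j ∈ 𝒴 j) → ∑ j ∈ s, y j = 0 →
      ∀ j ∈ s, y j = 0)
    (hs : ∀ y, y ∈ AddSubgroup.closure {y | ∃ j, y ∈ 𝒴 j}) : DirectSum.IsInternal 𝒴 := by
  classical
  constructor
  · rw [injective_iff_map_eq_zero]
    intro z hz
    have h0 : ∑ j ∈ z.support, (z j : Y) = 0 := by
      rw [← hz]
      conv_rhs => rw [← DirectSum.sum_support_of z]
      rw [map_sum]
      exact Finset.sum_congr rfl fun j _ => (DirectSum.coeAddMonoidHom_of _ _ _).symm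
    have h := hi z.support (fun j => z j) (fun j _ => (z j).2) h0
    ext j
    by_cases hj : j ∈ z.support
    · exact h j hj
    · rw [DFinsupp.notMem_support_iff] at hj
      rw [hj]
      rfl
  · intro y
    induction hs y using AddSubgroup.closure_induction with
    | mem y hy =>
      obtain ⟨j, hj⟩ := hy
      exact ⟨DirectSum.of (fun j => 𝒴 j) j ⟨y, hj⟩, DirectSum.coeAddMonoidHom_of _ _ _⟩
    | zero => exact ⟨0, map_zero _⟩
    | add x y _ _ hx hy =>
      obtain ⟨x', rfl⟩ := hx
      obtain ⟨y', rfl⟩ := hy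
      exact ⟨x' + y', map_add _ _ _⟩
    | neg x _ hx =>
      obtain ⟨x', rfl⟩ := hx
      exact ⟨-x', map_neg _ _⟩

theorem IsGradedModule.mem_closure {A : Type u} [CommRing A] [Algebra K A]
    {𝒜 : ℕ → Submodule K A} {Y : Type u} [AddCommGroup Y] [Module A Y] {𝒴 : ℤ → AddSubgroup Y}
    (h : IsGradedModule 𝒜 𝒴) (y : Y) : y ∈ AddSubgroup.closure {y | ∃ j, y ∈ 𝒴 j} := by
  classical
  obtain ⟨z, rfl⟩ := h.isInternal.surjective y
  induction z using DirectSum.induction_on with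
  | zero => rw [map_zero]; exact zero_mem _
  | of j x =>
    rw [DirectSum.coeAddMonoidHom_of]
    exact AddSubgroup.subset_closure ⟨j, x.2⟩
  | add x y hx hy => rw [map_add]; exact add_mem hx hy

/-- A homogeneous `K`-basis of a graded module. -/
structure HomogeneousBasis (A : Type u) [CommRing A] [Algebra K A] {Y : Type u} [AddCommGroup Y]
    [Module A Y] (𝒴 : ℤ → AddSubgroup Y) where
  κ : Type u
  deg : κ → ℤ
  v : κ → Y
  v_mem : ∀ c, v c ∈ 𝒴 (deg c)
  v_ne : ∀ c, v c ≠ 0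
  span : ∀ j, ∀ y ∈ 𝒴 j, ∃ p : κ →₀ K, (∀ c, p c ≠ 0 → deg c = j) ∧
    (p.sum fun c t => algebraMap K A t • v c) = y
  indep : ∀ j, ∀ p : κ →₀ K, (∀ c, p c ≠ 0 → deg c = j) →
    (p.sum fun c t => algebraMap K A t • v c) = 0 → p = 0

/-- Each homogeneous component is a `K`-vector space, because `K` maps into `𝒜 0`; bases of the
components are put together. -/
theorem exists_homogeneousBasis {A : Type u} [CommRing A] [Algebra K A]
    (𝒜 : ℕ → Submodule K A) [GradedAlgebra 𝒜] {Y : Type u} [AddCommGroup Y] [Module A Y]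
    {𝒴 : ℤ → AddSubgroup Y} (h : GradedSMul 𝒜 𝒴) :
    Nonempty (HomogeneousBasis (K := K) A 𝒴) := by
  classical
  let _ : Module K Y := Module.compHom Y (algebraMap K A)
  have hsmul : ∀ (t : K) (y : Y), t • y = algebraMap K A t • y := fun _ _ => rfl
  let S : ℤ → Submodule K Y := fun j =>
    { 𝒴 j with
      smul_mem' := fun t y hy => by
        have := h 0 j (algebraMap K A t) y (SetLike.algebraMap_mem_graded 𝒜 t) hy
        simpa [hsmul] using this }
  let b : ∀ j, Module.Basis (Module.Basis.ofVectorSpaceIndex K (S j)) K (S j) := fun j =>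
    Module.Basis.ofVectorSpace K (S j)
  let emb : ∀ j, Module.Basis.ofVectorSpaceIndex K (S j) ↪
      Σ j, Module.Basis.ofVectorSpaceIndex K (S j) := fun j =>
    Function.Embedding.sigmaMk (β := fun j => Module.Basis.ofVectorSpaceIndex K (S j)) j
  refine ⟨⟨Σ j, Module.Basis.ofVectorSpaceIndex K (S j), fun c => c.1, fun c => (b c.1 c.2 : Y),
    fun c => (b c.1 c.2).2, fun c => ?_, fun j y hy => ?_, fun j p hp h0 => ?_⟩⟩
  · intro h0
    exact (b c.1).ne_zero c.2 (Subtype.ext h0)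
  · refine ⟨((b j).repr ⟨y, hy⟩).embDomain (emb j), fun c hc => ?_, ?_⟩
    · by_contra hcj
      refine hc (Finsupp.embDomain_of_notMem_range _ _ _ ?_)
      rintro ⟨i, rfl⟩
      exact hcj rfl
    · rw [Finsupp.sum_embDomain]
      have := congrArg (fun z : S j => (z : Y)) ((b j).linearCombination_repr ⟨y, hy⟩)
      rw [Finsupp.linearCombination_apply] at this
      simp only [Finsupp.sum] at this ⊢
      rw [Submodule.coe_sum] at this
      exact this
  · have hp' : Finsupp.embDomain (emb j)
        (p.comapDomain (emb j)
          (emb j).injective.injOn) = p := by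
      apply Finsupp.embDomain_comapDomain
      intro c hc
      have := hp c (Finsupp.mem_support_iff.1 hc)
      subst this
      exact ⟨c.2, rfl⟩
    rw [← hp', Finsupp.sum_embDomain] at h0
    have hli := linearIndependent_iff.1 (b j).linearIndependent
      (p.comapDomain (emb j) (emb j).injective.injOn) (by
        rw [Finsupp.linearCombination_apply]
        apply Subtype.ext
        simp only [Finsupp.sum] at h0 ⊢
        rw [Submodule.coe_sum]
        exact h0)
    rw [← hp', hli, Finsupp.embDomain_zero]

/-- A graded map of graded modules has a graded kernel. -/
theorem isGradedModule_ker {A : Type u} [CommRing A] [Algebra K A] (𝒜 : ℕ → Submodule K A)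
    [GradedAlgebra 𝒜] {κ : Type u} (deg : κ → ℤ) {Y : Type u} [AddCommGroup Y] [Module A Y]
    {𝒴 : ℤ → AddSubgroup Y} (h : IsGradedModule 𝒜 𝒴) (f : (κ →₀ A) →ₗ[A] Y)
    (hf : ∀ (b : κ) (i : ℕ) (a : A), a ∈ 𝒜 i → f (Finsupp.single b a) ∈ 𝒴 ((i : ℤ) + deg b)) :
    IsGradedModule 𝒜 (N := LinearMap.ker f) (fun j =>
      (freePiece 𝒜 deg j).toAddSubgroup.comap (LinearMap.ker f).subtype.toAddMonoidHom) := by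
  have hsm : ∀ (i : ℕ) (j : ℤ) (a : A) (x : κ →₀ A), a ∈ 𝒜 i → x ∈ freePiece 𝒜 deg j →
      a • x ∈ freePiece 𝒜 deg ((i : ℤ) + j) := by
    intro i j a x ha hx c
    rw [Finsupp.smul_apply, smul_eq_mul, add_sub_assoc]
    exact smul_mem_intPiece 𝒜 ha (hx c)
  refine ⟨isInternal_of_independent_of_closure (fun s y hy h0 j hj => ?_) ?_,
    fun i j a x ha hx => hsm i j a _ ha hx⟩
  · refine Subtype.ext (freePiece_eq_zero_of_sum 𝒜 deg s (fun j => (y j : κ →₀ A)) hy ?_ j hj)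
    rw [← Submodule.coe_sum, h0]
    rfl
  -- The additive span of the homogeneous elements of the kernel is already stable under homogeneous
  -- scalars, hence under all scalars.
  · have key : ∀ x ∈ Submodule.span A {y : κ →₀ A | f y = 0 ∧ ∃ j, y ∈ freePiece 𝒜 deg j},
        x ∈ AddSubgroup.closure {y : κ →₀ A | f y = 0 ∧ ∃ j, y ∈ freePiece 𝒜 deg j} := by
      intro x hx
      induction hx using Submodule.span_induction with
      | mem x hx => exact AddSubgroup.subset_closure hx
      | zero => exact zero_mem _
      | add x y _ _ hx hy => exact add_mem hx hy
      | smul a x hxs hx =>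
        clear hxs
        induction hx using AddSubgroup.closure_induction with
        | mem x hx =>
          induction a using DirectSum.Decomposition.inductionOn 𝒜 with
          | zero => rw [zero_smul]; exact zero_mem _
          | @homogeneous i a =>
            obtain ⟨j, hj⟩ := hx.2
            exact AddSubgroup.subset_closure
              ⟨by rw [map_smul, hx.1, smul_zero], _, hsm i j a x a.2 hj⟩
          | add a a' h h' => rw [add_smul]; exact add_mem h h'
        | zero => rw [smul_zero]; exact zero_mem _
        | add x y _ _ hx hy => rw [smul_add]; exact add_mem hx hy
        | neg x _ hx => rw [smul_neg]; exact neg_mem hx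
    intro y
    have hy := key y (ker_le_span 𝒜 deg 𝒴 h.eq_zero_of_sum f hf y y.2)
    have hle : AddSubgroup.closure {y : κ →₀ A | f y = 0 ∧ ∃ j, y ∈ freePiece 𝒜 deg j} ≤
        (AddSubgroup.closure {y : LinearMap.ker f | ∃ j, y ∈ (freePiece 𝒜 deg j).toAddSubgroup.comap
          (LinearMap.ker f).subtype.toAddMonoidHom}).map
          (LinearMap.ker f).subtype.toAddMonoidHom := by
      rw [AddSubgroup.closure_le]
      rintro x ⟨hx, j, hj⟩
      exact ⟨⟨x, hx⟩, AddSubgroup.subset_closure ⟨j, hj⟩, rfl⟩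
    obtain ⟨z, hz, hzy⟩ := hle hy
    rwa [Subtype.ext hzy] at hz

/-- The component of degree `j` of `J Y`. -/
def smulPiece {A : Type u} [CommRing A] [Algebra K A] (𝒜 : ℕ → Submodule K A) (J : Ideal A)
    {Y : Type u} [AddCommGroup Y] [Module A Y] (𝒴 : ℤ → AddSubgroup Y) (j : ℤ) : AddSubgroup Y :=
  AddSubgroup.closure {x | ∃ i : ℕ, ∃ a ∈ J, a ∈ 𝒜 i ∧ ∃ y ∈ 𝒴 (j - i), a • y = x}

/-- As `J` is homogeneous, an element of `JY` is a finite sum of homogeneous elements of `JY`;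
directness of the grading leaves only the summand of degree `j`. -/
theorem IsGradedModule.mem_smulPiece {A : Type u} [CommRing A] [Algebra K A]
    {𝒜 : ℕ → Submodule K A} [GradedAlgebra 𝒜] {J : Ideal A}
    (hJ : ∀ a ∈ J, ∀ i, (DirectSum.decompose 𝒜 a i : A) ∈ J)
    {Y : Type u} [AddCommGroup Y] [Module A Y] {𝒴 : ℤ → AddSubgroup Y}
    (h : IsGradedModule 𝒜 𝒴) {j : ℤ} {y : Y} (hy : y ∈ 𝒴 j)
    (hyJ : y ∈ J • (⊤ : Submodule A Y)) : y ∈ smulPiece 𝒜 J 𝒴 j := by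
  classical
  have hle : ∀ l, smulPiece 𝒜 J 𝒴 l ≤ 𝒴 l := by
    intro l
    rw [smulPiece, AddSubgroup.closure_le]
    rintro _ ⟨i, a, -, ha, y, hy, rfl⟩
    have := h.smul_mem i _ a y ha hy
    rwa [add_sub_cancel] at this
  have hadd : ∀ t t' : Y, (∃ c : ℤ →₀ Y, (∀ l, c l ∈ smulPiece 𝒜 J 𝒴 l) ∧
      (c.sum fun _ y => y) = t) → (∃ c : ℤ →₀ Y, (∀ l, c l ∈ smulPiece 𝒜 J 𝒴 l) ∧
      (c.sum fun _ y => y) = t') → ∃ c : ℤ →₀ Y, (∀ l, c l ∈ smulPiece 𝒜 J 𝒴 l) ∧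
      (c.sum fun _ y => y) = t + t' := by
    rintro _ _ ⟨c, hc, rfl⟩ ⟨c', hc', rfl⟩
    exact ⟨c + c', fun l => add_mem (hc l) (hc' l), Finsupp.sum_add_index' (by simp) (by simp)⟩
  have key : ∀ t ∈ J • (⊤ : Submodule A Y), ∃ c : ℤ →₀ Y, (∀ l, c l ∈ smulPiece 𝒜 J 𝒴 l) ∧
      (c.sum fun _ y => y) = t := by
    intro t ht
    induction ht using Submodule.smul_induction_on' with
    | add x _ y _ hx hy => exact hadd x y hx hy
    | smul a ha y hyt =>
      clear hyt
      induction h.mem_closure y using AddSubgroup.closure_induction with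
      | zero => exact ⟨0, fun l => zero_mem _, by simp⟩
      | add x y _ _ hx hy => rw [smul_add]; exact hadd _ _ hx hy
      | neg x _ hx =>
        obtain ⟨c, hc, hcx⟩ := hx
        refine ⟨-c, fun l => neg_mem (hc l), ?_⟩
        rw [Finsupp.sum_neg_index (by simp), smul_neg, ← hcx, Finsupp.sum, Finsupp.sum,
          Finset.sum_neg_distrib]
      | mem y hy =>
        obtain ⟨l, hl⟩ := hy
        rw [← DirectSum.sum_support_decompose 𝒜 a, Finset.sum_smul]
        have hall : ∀ s : Finset ℕ, ∃ c : ℤ →₀ Y, (∀ l, c l ∈ smulPiece 𝒜 J 𝒴 l) ∧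
            (c.sum fun _ y => y) = ∑ i ∈ s, (DirectSum.decompose 𝒜 a i : A) • y := by
          intro s
          induction s using Finset.induction_on with
          | empty => exact ⟨0, fun l => zero_mem _, by simp⟩
          | insert i s hi ih =>
            rw [Finset.sum_insert hi]
            refine hadd _ _ ⟨Finsupp.single ((i : ℤ) + l)
              ((DirectSum.decompose 𝒜 a i : A) • y), fun l' => ?_, by simp⟩ ih
            rw [Finsupp.single_apply]
            split_ifs with hl'
            · refine AddSubgroup.subset_closure
                ⟨i, _, hJ a ha i, SetLike.coe_mem _, y, ?_, rfl⟩
              rwa [← hl', add_sub_cancel_left]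
            · exact zero_mem _
        exact hall _
  obtain ⟨c, hc, hcy⟩ := key y hyJ
  -- The components `c`, with `y` subtracted in degree `j`, sum to zero. Inserting `j` covers the
  -- case where it is not in the support of `c`.
  have h0 := h.eq_zero_of_sum (insert j c.support) (fun l => c l - if l = j then y else 0)
    (fun l _ => sub_mem (hle l (hc l)) (by
      split_ifs with hl
      · rwa [hl]
      · exact zero_mem _))
    (by
      rw [Finset.sum_sub_distrib, Finset.sum_ite_eq', if_pos (Finset.mem_insert_self _ _),
        sub_eq_zero]
      rw [← hcy, Finsupp.sum]
      refine (Finset.sum_subset (Finset.subset_insert _ _) fun l _ hl => ?_).symm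
      rwa [Finsupp.notMem_support_iff] at hl) j (Finset.mem_insert_self _ _)
  rw [if_pos rfl, sub_eq_zero] at h0
  rw [← h0]
  exact hc j

/-- Extension of scalars along a surjection. -/
theorem exists_baseChange {A B : Type u} [CommRing A] [CommRing B] (φ : A →+* B)
    (hφ : Function.Surjective φ) (Y : Type u) [AddCommGroup Y] [Module A Y] :
    ∃ (X : Type u) (_ : AddCommGroup X) (_ : Module B X) (π : Y →ₛₗ[φ] X),
      Function.Surjective π ∧ ∀ y, π y = 0 ↔ y ∈ RingHom.ker φ • (⊤ : Submodule A Y) := by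
  let X := Y ⧸ (RingHom.ker φ • (⊤ : Submodule A Y))
  have hker : ∀ a, a ∈ RingHom.ker φ → Module.toAddMonoidEnd A X a = 0 := by
    intro a ha
    ext x
    obtain ⟨y, rfl⟩ := Submodule.mkQ_surjective _ x
    change a • (Submodule.mkQ (RingHom.ker φ • (⊤ : Submodule A Y))) y = 0
    rw [← map_smul, Submodule.mkQ_apply, Submodule.Quotient.mk_eq_zero]
    exact Submodule.smul_mem_smul ha Submodule.mem_top
  have hinv : Function.RightInverse (Function.surjInv hφ) φ := Function.rightInverse_surjInv hφ
  let ψ : B →+* AddMonoid.End X :=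
    φ.liftOfRightInverse (Function.surjInv hφ) hinv ⟨Module.toAddMonoidEnd A X, hker⟩
  have hψ : ∀ a, ψ (φ a) = Module.toAddMonoidEnd A X a := fun a =>
    RingHom.liftOfRightInverse_comp_apply φ _ hinv ⟨Module.toAddMonoidEnd A X, hker⟩ a
  let _ : Module B X := Module.compHom X ψ
  refine ⟨X, inferInstance, inferInstance,
    { toFun := Submodule.mkQ _, map_add' := map_add _, map_smul' := fun a y => ?_ },
    Submodule.mkQ_surjective _, fun y => ?_⟩
  · rw [map_smul]
    exact (DFunLike.congr_fun (hψ a) _).symm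
  · exact Submodule.Quotient.mk_eq_zero _

theorem exists_linearMap_of_surjective {A B : Type u} [CommRing A] [CommRing B] {φ : A →+* B}
    (hφ : Function.Surjective φ) {Y X Z : Type u} [AddCommGroup Y] [Module A Y] [AddCommGroup X]
    [Module B X] [AddCommGroup Z] [Module B Z] (π : Y →ₛₗ[φ] X) (hπ : Function.Surjective π)
    (g : Y →ₛₗ[φ] Z) (hg : ∀ y, π y = 0 → g y = 0) : ∃ f : X →ₗ[B] Z, ∀ y, f (π y) = g y := by
  have hs : ∀ x, π (Function.surjInv hπ x) = x := Function.surjInv_eq hπ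
  have hy : ∀ y, g (Function.surjInv hπ (π y)) = g y := by
    intro y
    rw [← sub_eq_zero, ← map_sub]
    exact hg _ (by rw [map_sub, hs, sub_self])
  refine ⟨{ toFun := fun x => g (Function.surjInv hπ x), map_add' := fun x x' => ?_,
            map_smul' := fun b x => ?_ }, hy⟩
  · rw [← map_add, ← hy (_ + _), map_add, hs, hs]
  · obtain ⟨a, rfl⟩ := hφ b
    rw [RingHom.id_apply, ← map_smulₛₗ, ← hy (a • _), map_smulₛₗ, hs]

/-! ## Reductions and comparisons -/

/-- The grading of the algebra, extended by zero to negative degrees. -/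
def ringPiece {A : Type u} [CommRing A] [Algebra K A] (𝒜 : ℕ → Submodule K A) (j : ℤ) :
    AddSubgroup A :=
  (intPiece 𝒜 j).toAddSubgroup

theorem mem_ringPiece_of_mem {A : Type u} [CommRing A] [Algebra K A] {𝒜 : ℕ → Submodule K A}
    {i : ℕ} {j : ℤ} (hij : (i : ℤ) = j) {a : A} (ha : a ∈ 𝒜 i) : a ∈ ringPiece 𝒜 j := by
  subst hij
  change a ∈ intPiece 𝒜 i
  rw [intPiece, if_pos (by omega)]
  exact ha

theorem mem_ringPiece {A : Type u} [CommRing A] [Algebra K A] {𝒜 : ℕ → Submodule K A} {j : ℤ}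
    {a : A} (ha : a ∈ ringPiece 𝒜 j) : a = 0 ∨ ∃ i : ℕ, (i : ℤ) = j ∧ a ∈ 𝒜 i := by
  change a ∈ intPiece 𝒜 j at ha
  unfold intPiece at ha
  split_ifs at ha with h
  · exact Or.inr ⟨j.toNat, by omega, ha⟩
  · exact Or.inl ((Submodule.mem_bot K).1 ha)

theorem gradedSMul_ringPiece {A : Type u} [CommRing A] [Algebra K A] (𝒜 : ℕ → Submodule K A)
    [GradedAlgebra 𝒜] : GradedSMul 𝒜 (ringPiece 𝒜) :=
  fun _ _ _ _ ha hx => smul_mem_intPiece 𝒜 ha hx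

theorem GradedSMul.strandOf {A : Type u} [CommRing A] [Algebra K A] {𝒜 : ℕ → Submodule K A}
    {X : Type u} [AddCommGroup X] [Module A X] {𝒳 : ℤ → AddSubgroup X} (h : GradedSMul 𝒜 𝒳)
    {κ : Type u} (deg : κ → ℤ) : GradedSMul 𝒜 (X := κ →₀ X) (strandOf deg 𝒳) := by
  intro i j a x ha hx c
  rw [Finsupp.smul_apply, add_sub_assoc]
  exact h i _ a _ ha (hx c)

/-! ### Free covers on homogeneous bases and their syzygies. -/

namespace HomogeneousBasis

variable {A : Type u} [CommRing A] [Algebra K A] {𝒜 : ℕ → Submodule K A} [GradedAlgebra 𝒜]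
  {Y : Type u} [AddCommGroup Y] [Module A Y] {𝒴 : ℤ → AddSubgroup Y}
  (b : HomogeneousBasis (K := K) A 𝒴)

/-- The map from the graded free module on a homogeneous basis. -/
def cover : (b.κ →₀ A) →ₗ[A] Y :=
  Finsupp.linearCombination A b.v

/-- The grading of the kernel of `cover`. -/
def kerPiece (𝒜 : ℕ → Submodule K A) (j : ℤ) : AddSubgroup (LinearMap.ker b.cover) :=
  (strandOf b.deg (ringPiece 𝒜) j).comap (LinearMap.ker b.cover).subtype.toAddMonoidHom

theorem cover_single (c : b.κ) (a : A) : b.cover (Finsupp.single c a) = a • b.v c :=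
  Finsupp.linearCombination_single _ _ _

omit [GradedAlgebra 𝒜] in
theorem cover_mem (h : GradedSMul 𝒜 𝒴) (j : ℤ) (p : b.κ →₀ A)
    (hp : p ∈ strandOf b.deg (ringPiece 𝒜) j) : b.cover p ∈ 𝒴 j := by
  rw [cover, Finsupp.linearCombination_apply]
  refine AddSubgroup.sum_mem _ fun c _ => ?_
  change p c • b.v c ∈ 𝒴 j
  obtain h0 | ⟨i, hi, ha⟩ := mem_ringPiece (hp c)
  · rw [h0, zero_smul]
    exact zero_mem _
  · have := h i _ _ _ ha (b.v_mem c)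
    rwa [hi, sub_add_cancel] at this

theorem cover_surj (j : ℤ) (y : Y) (hy : y ∈ 𝒴 j) :
    ∃ p ∈ strandOf b.deg (ringPiece 𝒜) j, b.cover p = y := by
  obtain ⟨p, hp, rfl⟩ := b.span j y hy
  refine ⟨p.mapRange (algebraMap K A) (map_zero _), fun c => ?_, ?_⟩
  · rw [Finsupp.mapRange_apply]
    by_cases hc : p c = 0
    · rw [hc, map_zero]
      exact zero_mem _
    · exact mem_ringPiece_of_mem (by rw [hp c hc]; simp) (SetLike.algebraMap_mem_graded 𝒜 _)
  · rw [cover, Finsupp.linearCombination_apply, Finsupp.sum_mapRange_index (by simp)]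

theorem cover_surjective (h : IsGradedModule 𝒜 𝒴) : Function.Surjective b.cover := by
  intro y
  have hle : AddSubgroup.closure {y | ∃ j, y ∈ 𝒴 j} ≤ b.cover.toAddMonoidHom.range := by
    rw [AddSubgroup.closure_le]
    rintro y ⟨j, hj⟩
    obtain ⟨p, -, hp⟩ := b.cover_surj (𝒜 := 𝒜) j y hj
    exact ⟨p, hp⟩
  exact hle (h.mem_closure y)

theorem le_deg {q : ℤ} (hq : ∀ j < q, ∀ y ∈ 𝒴 j, y = 0) (c : b.κ) : q ≤ b.deg c := by
  by_contra h
  exact b.v_ne c (hq _ (not_le.1 h) _ (b.v_mem c))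

theorem strandExact (h : GradedSMul 𝒜 𝒴) :
    StrandExact (LinearMap.ker b.cover).subtype b.cover (b.kerPiece 𝒜)
      (strandOf b.deg (ringPiece 𝒜)) 𝒴 where
  injective := Subtype.val_injective
  f_mem _ _ hx := hx
  g_mem := b.cover_mem h
  surj := b.cover_surj
  ker _ y hy hy0 := ⟨⟨y, hy0⟩, hy, rfl⟩
  comp x := x.2

theorem isGradedModule_kerPiece (h : IsGradedModule 𝒜 𝒴) :
    IsGradedModule 𝒜 (b.kerPiece 𝒜) := by
  refine isGradedModule_ker 𝒜 b.deg h b.cover fun c i a ha => ?_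
  rw [cover_single]
  exact h.smul_mem i _ a _ ha (b.v_mem c)

omit [GradedAlgebra 𝒜] in
/-- The kernel of `cover` lives in higher degrees, as the basis is minimal in the lowest degree. -/
theorem kerPiece_eq_zero (h0 : ∀ a ∈ 𝒜 0, ∃ c : K, algebraMap K A c = a) {q : ℤ}
    (hq : ∀ j < q, ∀ y ∈ 𝒴 j, y = 0) (j : ℤ) (hj : j < q + 1) (y : LinearMap.ker b.cover)
    (hy : y ∈ b.kerPiece 𝒜 j) : y = 0 := by
  classical
  have hy' : (y : b.κ →₀ A) ∈ strandOf b.deg (ringPiece 𝒜) j := hy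
  -- A nonzero coordinate has degree `j - deg c ≤ q - q = 0`. So all coordinates are scalars, and
  -- the independence of the basis elements of degree `j` applies.
  have hdeg : ∀ c, (y : b.κ →₀ A) c ≠ 0 → b.deg c = j ∧ (y : b.κ →₀ A) c ∈ 𝒜 0 := by
    intro c hc
    obtain hz | ⟨i, hi, ha⟩ := mem_ringPiece (hy' c)
    · exact absurd hz hc
    · have := b.le_deg hq c
      have hi0 : i = 0 := by omega
      subst hi0
      exact ⟨by omega, ha⟩
  have hex : ∀ c, ∃ t : K, algebraMap K A t = (y : b.κ →₀ A) c := by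
    intro c
    by_cases hc : (y : b.κ →₀ A) c = 0
    · exact ⟨0, by rw [hc, map_zero]⟩
    · exact h0 _ (hdeg c hc).2
  choose t ht using hex
  let p : b.κ →₀ K := Finsupp.onFinset (y : b.κ →₀ A).support
    (fun c => if (y : b.κ →₀ A) c = 0 then 0 else t c) fun c hc => by
      rw [Finsupp.mem_support_iff]
      intro h
      exact hc (if_pos h)
  have hp : ∀ c, algebraMap K A (p c) = (y : b.κ →₀ A) c := by
    intro c
    change algebraMap K A (if _ then _ else _) = _
    split_ifs with h
    · rw [map_zero, h]
    · exact ht c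
  have hpy : p.mapRange (algebraMap K A) (map_zero _) = y := by
    ext c
    rw [Finsupp.mapRange_apply, hp]
  have hp0 : p = 0 := by
    refine b.indep j p (fun c hc => (hdeg c fun h => hc (if_pos h)).1) ?_
    have hcov : b.cover (y : b.κ →₀ A) = 0 := y.2
    rwa [← hpy, cover, Finsupp.linearCombination_apply,
      Finsupp.sum_mapRange_index (by simp)] at hcov
  apply Subtype.ext
  rw [← hpy, hp0, Finsupp.mapRange_zero]
  rfl

end HomogeneousBasis

theorem gradedSMul_residuePiece {A : Type u} [CommRing A] [Algebra K A]
    (𝒜 : ℕ → Submodule K A) [GradedAlgebra 𝒜] : GradedSMul 𝒜 (residuePiece 𝒜) := by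
  intro i j a x ha hx
  obtain ⟨y, rfl⟩ := Ideal.Quotient.mk_surjective x
  by_cases hj : j = 0
  · rcases Nat.eq_zero_or_pos i with rfl | hi
    · rw [hj, residuePiece, if_pos (by simp)]
      trivial
    · have : a • (Ideal.Quotient.mk (HomogeneousIdeal.irrelevant 𝒜).toIdeal y) = 0 := by
        change Ideal.Quotient.mk _ (a * y) = 0
        rw [Ideal.Quotient.eq_zero_iff_mem]
        exact Ideal.mul_mem_right _ _ (HomogeneousIdeal.mem_irrelevant_of_mem 𝒜 hi ha)
      rw [this]
      exact zero_mem _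
  · rw [residuePiece, if_neg hj, AddSubgroup.mem_bot] at hx
    rw [hx, smul_zero]
    exact zero_mem _

theorem isGradedModule_residuePiece {A : Type u} [CommRing A] [Algebra K A]
    (𝒜 : ℕ → Submodule K A) [GradedAlgebra 𝒜] : IsGradedModule 𝒜 (residuePiece 𝒜) := by
  refine ⟨isInternal_of_independent_of_closure (fun s y hy h0 => ?_) (fun y => ?_),
    gradedSMul_residuePiece 𝒜⟩
  · have hne : ∀ j ∈ s, j ≠ 0 → y j = 0 := by
      intro j hj hj0
      have := hy j hj
      rwa [residuePiece, if_neg hj0, AddSubgroup.mem_bot] at this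
    intro j hj
    by_cases hj0 : j = 0
    · subst hj0
      rwa [Finset.sum_eq_single_of_mem 0 hj hne] at h0
    · exact hne j hj hj0
  · refine AddSubgroup.subset_closure ⟨0, ?_⟩
    rw [residuePiece, if_pos rfl]
    trivial

theorem exists_algebraMap_eq_residue {A : Type u} [CommRing A] [Algebra K A]
    {𝒜 : ℕ → Submodule K A} [GradedAlgebra 𝒜] (h0 : ∀ a ∈ 𝒜 0, ∃ c : K, algebraMap K A c = a)
    (x : Residue 𝒜) :
    ∃ t : K, Ideal.Quotient.mk (HomogeneousIdeal.irrelevant 𝒜).toIdeal (algebraMap K A t) = x := by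
  obtain ⟨a, rfl⟩ := Ideal.Quotient.mk_surjective x
  obtain ⟨t, ht⟩ := h0 (GradedRing.proj 𝒜 0 a) (SetLike.coe_mem (DirectSum.decompose 𝒜 a 0))
  refine ⟨t, ?_⟩
  rw [ht, Ideal.Quotient.eq, HomogeneousIdeal.mem_iff]
  rw [HomogeneousIdeal.mem_irrelevant_iff, map_sub, sub_eq_zero, GradedRing.proj_apply,
    GradedRing.proj_apply, DirectSum.decompose_coe, DirectSum.of_eq_same]

/-- The homology with coefficients in a graded vector space is controlled by that with
coefficients in the residue field. -/
theorem FreeComplex.Vanishes.of_residue {A : Type u} [CommRing A] [Algebra K A]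
    {𝒜 : ℕ → Submodule K A} [GradedAlgebra 𝒜] (C : FreeComplex 𝒜)
    (h0 : ∀ a ∈ 𝒜 0, ∃ c : K, algebraMap K A c = a) {X : Type u} [AddCommGroup X] [Module A X]
    {𝒳 : ℤ → AddSubgroup X} (h : GradedSMul 𝒜 𝒳)
    (hkill : ∀ a ∈ (HomogeneousIdeal.irrelevant 𝒜).toIdeal, ∀ x : X, a • x = 0) {s : ℤ}
    (hs : ∀ j < s, ∀ x ∈ 𝒳 j, x = 0) {n : ℕ} (hk : ∀ j < (n : ℤ), C.Vanishes (residuePiece 𝒜) n j)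
    (j : ℤ) (hj : j < n + s) : C.Vanishes 𝒳 n j := by
  classical
  obtain ⟨b⟩ := exists_homogeneousBasis 𝒜 h
  let μ : K →+ Residue 𝒜 :=
    ((Ideal.Quotient.mk (HomogeneousIdeal.irrelevant 𝒜).toIdeal).comp
      (algebraMap K A)).toAddMonoidHom
  -- Since `A_+` kills `X`, each basis element defines a map from `k`; together they identify `X`
  -- degreewise with a direct sum of shifts of `k`.
  let g : (b.κ →₀ Residue 𝒜) →ₗ[A] X := Finsupp.lsum ℕ fun c =>
    Submodule.liftQ (HomogeneousIdeal.irrelevant 𝒜).toIdeal (LinearMap.toSpanSingleton A X (b.v c))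
      (fun a ha => hkill a ha (b.v c))
  have hg : ∀ p : b.κ →₀ K, g (push id μ p) = p.sum fun c t => algebraMap K A t • b.v c := by
    intro p
    induction p using Finsupp.induction_linear with
    | zero => simp
    | add x y hx hy =>
      rw [map_add, map_add, hx, hy, Finsupp.sum_add_index' (by simp)
        (by intros; rw [map_add, add_smul])]
    | single c t =>
      rw [push_single, Finsupp.sum_single_index (by simp)]
      change Finsupp.lsum ℕ _ (Finsupp.single c (μ t)) = _
      rw [Finsupp.lsum_single]
      rfl
  -- `K` in degree zero. Residue vectors lift to vectors over `K`, for which spanning and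
  -- independence of the basis are formulated.
  let 𝒦 : ℤ → AddSubgroup K := fun i => if i = 0 then ⊤ else ⊥
  have h𝒦 : ∀ (i : ℤ) (p : b.κ →₀ K), p ∈ strandOf b.deg 𝒦 i ↔ ∀ c, p c ≠ 0 → b.deg c = i := by
    intro i p
    refine forall_congr' fun c => ?_
    change p c ∈ (if i - b.deg c = 0 then ⊤ else ⊥ : AddSubgroup K) ↔ _
    split_ifs with hc
    · exact ⟨fun _ _ => by omega, fun _ => trivial⟩
    · rw [AddSubgroup.mem_bot]
      exact ⟨fun h h' => absurd h h', fun h => by_contra fun h' => hc (by rw [h h', sub_self])⟩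
  have hlift : ∀ i, ∀ x ∈ strandOf b.deg (residuePiece 𝒜) i,
      ∃ p ∈ strandOf b.deg 𝒦 i, push id μ p = x := by
    intro i x hx
    refine exists_push_eq (𝒳 := residuePiece 𝒜) (fun _ => rfl) Function.surjective_id
      (fun l y hy => ?_) hx
    change ∃ t ∈ (if l = 0 then ⊤ else ⊥ : AddSubgroup K), μ t = y
    unfold residuePiece at hy
    split_ifs at hy ⊢ with hl
    · obtain ⟨t, ht⟩ := exists_algebraMap_eq_residue h0 y
      exact ⟨t, trivial, ht⟩
    · rw [AddSubgroup.mem_bot] at hy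
      exact ⟨0, zero_mem _, by rw [hy, map_zero]⟩
  have hsub : ∀ i (p : b.κ →₀ K), (∀ c, p c ≠ 0 → b.deg c = i) →
      (p.sum fun c t => algebraMap K A t • b.v c) ∈ 𝒳 i := by
    intro i p hp
    refine AddSubgroup.sum_mem _ fun c hc => ?_
    rw [← hp c (Finsupp.mem_support_iff.1 hc)]
    simpa using h 0 _ (algebraMap K A (p c)) (b.v c) (SetLike.algebraMap_mem_graded 𝒜 _)
      (b.v_mem c)
  refine Vanishes.of_bijective C ((gradedSMul_residuePiece 𝒜).strandOf b.deg) g ?_ ?_ ?_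
    (Vanishes.finsupp C b.deg fun c => hk _ ?_)
  · intro i x hx
    obtain ⟨p, hp, rfl⟩ := hlift i x hx
    rw [hg]
    exact hsub i p ((h𝒦 i p).1 hp)
  · intro i x hx
    obtain ⟨p, hp, rfl⟩ := b.span i x hx
    refine ⟨push id μ p, push_mem_strandOf (fun _ => rfl) (𝒴 := 𝒦) (fun l t ht => ?_)
      ((h𝒦 i p).2 hp), hg p⟩
    change t ∈ (if l = 0 then ⊤ else ⊥ : AddSubgroup K) at ht
    unfold residuePiece
    split_ifs at ht ⊢
    · trivial
    · rw [AddSubgroup.mem_bot] at ht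
      rw [ht, map_zero]
      exact zero_mem _
  · intro i x hx hx0
    obtain ⟨p, hp, rfl⟩ := hlift i x hx
    rw [hg] at hx0
    rw [b.indep i p ((h𝒦 i p).1 hp) hx0, map_zero]
  · have := b.le_deg hs c
    omega

/-- The homomorphism of rings underlying a homomorphism of graded algebras. -/
abbrev gradedToRingHom {Q R : Type u} [CommRing Q] [Algebra K Q] [CommRing R] [Algebra K R]
    {𝒬 : ℕ → Submodule K Q} {ℛ : ℕ → Submodule K R} [GradedAlgebra 𝒬] [GradedAlgebra ℛ]
    (φ : 𝒬 →ₐᵍ[K] ℛ) : Q →+* R :=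
  ((φ : Q →ₐ[K] R) : Q →+* R)

/-- A comparison over `φ` of acyclic complexes of graded free modules. -/
structure Comparison {Q R : Type u} [CommRing Q] [Algebra K Q] [CommRing R] [Algebra K R]
    {𝒬 : ℕ → Submodule K Q} {ℛ : ℕ → Submodule K R} [GradedAlgebra 𝒬] [GradedAlgebra ℛ]
    (φ : 𝒬 →ₐᵍ[K] ℛ)
    (C : FreeComplex 𝒬) (D : FreeComplex ℛ) where
  g : ∀ n, C.ι n → D.ι n
  deg_eq : ∀ n b, D.deg n (g n b) = C.deg n b
  e_eq : ∀ n b, D.e n (g (n + 1) b) = push (g n) (gradedToRingHom φ).toAddMonoidHom (C.e n b)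
  g_zero_bijective : Function.Bijective (g 0)
  g_one_surjective : Function.Surjective (g 1)
  exists_rel : ∀ (b : C.ι 0) (i : ℕ) (a : Q), a ∈ 𝒬 i → φ a = 0 →
    ∃ b' : C.ι 1, C.deg 1 b' = i + C.deg 0 b ∧ C.e 0 b' = Finsupp.single b a
  exact_source : ∀ n j, C.Vanishes (ringPiece 𝒬) (n + 1) j
  exact_target : ∀ n j, D.Vanishes (ringPiece ℛ) (n + 1) j

/-- In each degree, `X` is the extension of scalars of `Y` along `φ`. -/
structure Reduction {Q R : Type u} [CommRing Q] [Algebra K Q] [CommRing R] [Algebra K R]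
    {𝒬 : ℕ → Submodule K Q} {ℛ : ℕ → Submodule K R} [GradedAlgebra 𝒬] [GradedAlgebra ℛ]
    (φ : 𝒬 →ₐᵍ[K] ℛ) {Y X : Type u}
    [AddCommGroup Y] [Module Q Y] [AddCommGroup X] [Module R X] (π : Y →ₛₗ[gradedToRingHom φ] X)
    (𝒴 : ℤ → AddSubgroup Y) (𝒳 : ℤ → AddSubgroup X) : Prop where
  mem : ∀ j, ∀ y ∈ 𝒴 j, π y ∈ 𝒳 j
  surj : ∀ j, ∀ x ∈ 𝒳 j, ∃ y ∈ 𝒴 j, π y = x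
  ker : ∀ j, ∀ y ∈ 𝒴 j, π y = 0 → y ∈ smulPiece 𝒬 (RingHom.ker (gradedToRingHom φ)) 𝒴 j

/-! ### Comparison maps with coefficients, and linear coefficient modules. -/

section Comparison

variable {Q R : Type u} [CommRing Q] [Algebra K Q] [CommRing R] [Algebra K R]
  {𝒬 : ℕ → Submodule K Q} {ℛ : ℕ → Submodule K R} [GradedAlgebra 𝒬] [GradedAlgebra ℛ]
  {φ : 𝒬 →ₐᵍ[K] ℛ}
  {C : FreeComplex 𝒬} {D : FreeComplex ℛ} (H : Comparison φ C D)
  {Y X : Type u} [AddCommGroup Y] [Module Q Y] [AddCommGroup X] [Module R X]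
  (π : Y →ₛₗ[gradedToRingHom φ] X) {𝒴 : ℤ → AddSubgroup Y} {𝒳 : ℤ → AddSubgroup X}

namespace Comparison

/-- The comparison with coefficients. -/
def map (n : ℕ) : (C.ι n →₀ Y) →+ (D.ι n →₀ X) :=
  push (H.g n) π.toAddMonoidHom

theorem act_map (n : ℕ) (x : C.ι (n + 1) →₀ Y) :
    act (D.e n) (H.map π (n + 1) x) = H.map π n (act (C.e n) x) :=
  act_push (gradedToRingHom φ) _ _ _ _ (H.e_eq n) _ (fun a y => map_smulₛₗ π a y) x

/-- The comparison of homologies with coefficients is injective. -/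
def InjectiveAt (𝒴 : ℤ → AddSubgroup Y) (𝒳 : ℤ → AddSubgroup X) (n : ℕ) (j : ℤ) : Prop :=
  ∀ z ∈ strandOf (C.deg n) 𝒴 j, C.IsCycle n z →
    (∃ w ∈ strandOf (D.deg (n + 1)) 𝒳 j, act (D.e n) w = H.map π n z) →
    ∃ v ∈ strandOf (C.deg (n + 1)) 𝒴 j, act (C.e n) v = z

variable {π}

theorem map_mem (hπ : Reduction φ π 𝒴 𝒳) {n : ℕ} {j : ℤ} {z : C.ι n →₀ Y}
    (hz : z ∈ strandOf (C.deg n) 𝒴 j) : H.map π n z ∈ strandOf (D.deg n) 𝒳 j :=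
  push_mem_strandOf (H.deg_eq n) hπ.mem hz

theorem isCycle_map {n : ℕ} {z : C.ι n →₀ Y} (hz : C.IsCycle n z) :
    D.IsCycle n (H.map π n z) := by
  cases n with
  | zero => trivial
  | succ n =>
    have hz' : act (C.e n) z = 0 := hz
    change act (D.e n) _ = 0
    rw [act_map, hz', map_zero]

/-- The field `exists_rel` makes `J` annihilate the zeroth homology of `C`, so nothing is lost there
by replacing `Y` with `Y/JY`. -/
theorem injectiveAt_zero (h𝒴 : GradedSMul 𝒬 𝒴) (hπ : Reduction φ π 𝒴 𝒳) (j : ℤ) :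
    H.InjectiveAt π 𝒴 𝒳 0 j := by
  classical
  rintro z hz - ⟨w, hw, hwz⟩
  obtain ⟨w', hw', rfl⟩ := exists_push_eq (H.deg_eq 1) H.g_one_surjective
    (f := π.toAddMonoidHom) hπ.surj hw
  change act (D.e 0) (H.map π 1 w') = _ at hwz
  rw [act_map, ← sub_eq_zero, ← map_sub] at hwz
  have key : ∀ (b : C.ι 0), ∀ y ∈ smulPiece 𝒬 (RingHom.ker (gradedToRingHom φ)) 𝒴 (j - C.deg 0 b),
      ∃ v ∈ strandOf (C.deg 1) 𝒴 j, act (C.e 0) v = Finsupp.single b y := by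
    intro b y hy
    induction hy using AddSubgroup.closure_induction with
    | mem y hy =>
      obtain ⟨i, a, haJ, ha, y, hy, rfl⟩ := hy
      obtain ⟨b', hdeg, hb'⟩ := H.exists_rel b i a ha haJ
      refine ⟨Finsupp.single b' y, single_mem_strandOf ?_, ?_⟩
      · rwa [hdeg, add_comm, ← sub_sub]
      · rw [act_single, hb', push_single]
        rfl
    | zero => exact ⟨0, zero_mem _, by simp⟩
    | add x y _ _ hx hy =>
      obtain ⟨v, hv, hvx⟩ := hx
      obtain ⟨t, ht, hty⟩ := hy
      exact ⟨v + t, add_mem hv ht, by rw [map_add, hvx, hty, Finsupp.single_add]⟩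
    | neg x _ hx =>
      obtain ⟨v, hv, hvx⟩ := hx
      exact ⟨-v, neg_mem hv, by rw [map_neg, hvx, Finsupp.single_neg]⟩
  have hmem := sub_mem (act_mem_strandOf h𝒴 (C.e_mem 0) hw') hz
  -- The boundary of the lifted chain misses `z` by `t`, whose coordinates lie in `JY`. By `key`
  -- these are boundaries, and they correct `w'`.
  set t := act (C.e 0) w' - z with ht
  have hker : ∀ b, t b ∈ smulPiece 𝒬 (RingHom.ker (gradedToRingHom φ)) 𝒴 (j - C.deg 0 b) := by
    intro b
    refine hπ.ker _ _ (hmem b) ?_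
    have := DFunLike.congr_fun hwz (H.g 0 b)
    rwa [map, push_apply_of_injective H.g_zero_bijective.1] at this
  choose s hs hst using fun b => key b _ (hker b)
  refine ⟨w' - ∑ b ∈ t.support, s b, sub_mem hw' (AddSubgroup.sum_mem _ fun b _ => hs b), ?_⟩
  have hsum : ∑ b ∈ t.support, act (C.e 0) (s b) = t := by
    conv_rhs => rw [← Finsupp.sum_single t]
    exact Finset.sum_congr rfl fun b _ => hst b
  rw [map_sub, map_sum, hsum, ht, sub_sub_cancel]

end Comparison

/-- Graded modules over `Q` in degrees at least `q`, on which elements of positive degree act as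
maps that factor through free modules, and whose homology vanishes below the diagonal. -/
structure IsLinear (C : FreeComplex 𝒬) (q : ℤ) (𝒴 : ℤ → AddSubgroup Y) :
    Prop where
  graded : IsGradedModule 𝒬 𝒴
  low : ∀ j < q, ∀ y ∈ 𝒴 j, y = 0
  factors : ∀ a ∈ (HomogeneousIdeal.irrelevant 𝒬).toIdeal, ∃ (κ : Type u)
    (f : Y →ₗ[Q] (κ →₀ Q)) (g : (κ →₀ Q) →ₗ[Q] Y), ∀ y, g (f y) = a • y
  vanishes : ∀ (n : ℕ) (j : ℤ), j < (n + 1 : ℕ) + q → C.Vanishes 𝒴 (n + 1) j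

/-- If `a = g ∘ f` on `Y` and `g'` lifts `g` through `cover`, then `a - g' ∘ f ∘ cover` maps the
free cover into the kernel of `cover`, and on that kernel it is multiplication by `a`. -/
theorem IsLinear.exists_section {q : ℤ} (h : IsLinear C q 𝒴)
    (b : HomogeneousBasis (K := K) Q 𝒴) (a : Q)
    (ha : a ∈ (HomogeneousIdeal.irrelevant 𝒬).toIdeal) :
    ∃ u : (b.κ →₀ Q) →ₗ[Q] LinearMap.ker b.cover, ∀ y : LinearMap.ker b.cover,
      u (y : b.κ →₀ Q) = a • y := by
  obtain ⟨κ, f, g, hfg⟩ := h.factors a ha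
  obtain ⟨g', hg'⟩ := Module.projective_lifting_property b.cover g (b.cover_surjective h.graded)
  have hg'' : ∀ x, b.cover (g' x) = g x := fun x => LinearMap.congr_fun hg' x
  refine ⟨LinearMap.codRestrict _ (a • LinearMap.id - g' ∘ₗ f ∘ₗ b.cover) fun x => ?_,
    fun y => Subtype.ext ?_⟩
  · simp [LinearMap.mem_ker, hg'', hfg]
  · have hy : b.cover (y : b.κ →₀ Q) = 0 := y.2
    simp [hy]

omit [GradedAlgebra 𝒬] in
theorem FreeComplex.Vanishes.cover {n : ℕ} {j : ℤ} (hC : ∀ j, C.Vanishes (ringPiece 𝒬) n j)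
    {κ : Type u} (deg : κ → ℤ) : C.Vanishes (X := κ →₀ Q) (strandOf deg (ringPiece 𝒬)) n j :=
  FreeComplex.Vanishes.finsupp C deg fun _ => hC _

/-- The bound `q` rises by one while the homological degree drops by one: `Tor_{n+1}` of the syzygy
comes from `Tor_{n+2}` of `Y`, so the bound `n + 2 + q` is kept. The factorization through a free
module is inclusion followed by the map of `exists_section`. -/
theorem IsLinear.kerPiece (hC : ∀ n j, C.Vanishes (ringPiece 𝒬) (n + 1) j)
    (h0 : ∀ a ∈ 𝒬 0, ∃ c : K, algebraMap K Q c = a) {q : ℤ}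
    (h : IsLinear C q 𝒴) (b : HomogeneousBasis (K := K) Q 𝒴) :
    IsLinear C (q + 1) (b.kerPiece 𝒬) where
  graded := b.isGradedModule_kerPiece h.graded
  low := b.kerPiece_eq_zero h0 h.low
  factors a ha := by
    obtain ⟨u, hu⟩ := h.exists_section b a ha
    exact ⟨b.κ, (LinearMap.ker b.cover).subtype, u, hu⟩
  vanishes n j hj := by
    refine (b.strandExact h.graded.smul_mem).vanishes_left C
      ((gradedSMul_ringPiece 𝒬).strandOf b.deg) (FreeComplex.Vanishes.cover (hC n) b.deg)
      (h.vanishes (n + 1) j ?_)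
    push_cast at hj ⊢
    omega

end Comparison

/-! ## Syzygies and the main induction -/

section Syzygy

variable {Q R : Type u} [CommRing Q] [Algebra K Q] [CommRing R] [Algebra K R]
  {𝒬 : ℕ → Submodule K Q} {ℛ : ℕ → Submodule K R} [GradedAlgebra 𝒬] [GradedAlgebra ℛ]
  {φ : 𝒬 →ₐᵍ[K] ℛ}

theorem decompose_mem_ker (a : Q) (ha : a ∈ RingHom.ker (gradedToRingHom φ)) (i : ℕ) :
    (DirectSum.decompose 𝒬 a i : Q) ∈ RingHom.ker (gradedToRingHom φ) := by
  have ha' : φ a = 0 := ha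
  change φ (DirectSum.decompose 𝒬 a i : Q) = 0
  rw [map_directSumDecompose 𝒬 ℛ φ, ha', DirectSum.decompose_zero]
  rfl

theorem exists_mem_map_eq (hφ : Function.Surjective φ) {i : ℕ} {r : R} (hr : r ∈ ℛ i) :
    ∃ a ∈ 𝒬 i, φ a = r := by
  obtain ⟨a, rfl⟩ := hφ r
  refine ⟨_, SetLike.coe_mem (DirectSum.decompose 𝒬 a i), ?_⟩
  rw [map_directSumDecompose 𝒬 ℛ φ, DirectSum.decompose_of_mem_same ℛ hr]

theorem exists_mem_ringPiece_map_eq (hφ : Function.Surjective φ) (j : ℤ) (r : R)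
    (hr : r ∈ ringPiece ℛ j) : ∃ a ∈ ringPiece 𝒬 j, φ a = r := by
  obtain rfl | ⟨i, hi, hr⟩ := mem_ringPiece hr
  · exact ⟨0, zero_mem _, map_zero _⟩
  · obtain ⟨a, ha, rfl⟩ := exists_mem_map_eq hφ hr
    exact ⟨a, mem_ringPiece_of_mem hi ha, rfl⟩

theorem exists_mem_irrelevant_map_eq (hφ : Function.Surjective φ) {r : R}
    (hr : r ∈ (HomogeneousIdeal.irrelevant ℛ).toIdeal) :
    ∃ a ∈ (HomogeneousIdeal.irrelevant 𝒬).toIdeal, φ a = r := by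
  obtain ⟨a, rfl⟩ := hφ r
  have hr' : GradedRing.proj ℛ 0 (φ a) = 0 := (HomogeneousIdeal.mem_irrelevant_iff ℛ _).1 hr
  refine ⟨a - GradedRing.proj 𝒬 0 a, ?_, ?_⟩
  · rw [HomogeneousIdeal.mem_iff, HomogeneousIdeal.mem_irrelevant_iff, map_sub, sub_eq_zero,
      GradedRing.proj_apply, GradedRing.proj_apply, DirectSum.decompose_coe, DirectSum.of_eq_same]
  · rw [GradedRing.proj_apply] at hr' ⊢
    rw [map_sub, map_directSumDecompose 𝒬 ℛ φ, hr', sub_zero]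

/-- Extension of scalars of a free module. -/
def freeReduction (φ : 𝒬 →ₐᵍ[K] ℛ) (κ : Type u) : (κ →₀ Q) →ₛₗ[gradedToRingHom φ] (κ →₀ R) where
  toFun := push id (gradedToRingHom φ).toAddMonoidHom
  map_add' := map_add _
  map_smul' a x := by
    ext c
    rw [push_id_apply, Finsupp.smul_apply, Finsupp.smul_apply, push_id_apply]
    exact map_mul (gradedToRingHom φ) _ _

theorem freeReduction_apply {κ : Type u} (x : κ →₀ Q) (c : κ) :
    freeReduction φ κ x c = φ (x c) :=
  push_id_apply _ _ _

theorem freeReduction_single {κ : Type u} (c : κ) (a : Q) :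
    freeReduction φ κ (Finsupp.single c a) = Finsupp.single c (φ a) :=
  push_single _ _ _ _

theorem reduction_freeReduction (hφ : Function.Surjective φ) {κ : Type u} (deg : κ → ℤ) :
    Reduction φ (freeReduction φ κ) (strandOf deg (ringPiece 𝒬)) (strandOf deg (ringPiece ℛ)) where
  mem j y hy c := by
    rw [freeReduction_apply]
    exact map_mem_intPiece φ (hy c)
  surj j x hx :=
    exists_push_eq (f := (gradedToRingHom φ).toAddMonoidHom) (fun _ => rfl)
      Function.surjective_id (exists_mem_ringPiece_map_eq hφ) hx
  ker j y hy hy0 := by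
    rw [← Finsupp.sum_single y]
    refine AddSubgroup.sum_mem _ fun c _ => ?_
    change Finsupp.single c (y c) ∈ _
    obtain h0 | ⟨i, hi, ha⟩ := mem_ringPiece (hy c)
    · rw [h0, Finsupp.single_zero]
      exact zero_mem _
    · refine AddSubgroup.subset_closure ⟨i, y c, ?_, ha, Finsupp.single c 1,
        single_mem_strandOf ?_, by simp⟩
      · have := DFunLike.congr_fun hy0 c
        rwa [freeReduction_apply] at this
      · exact mem_ringPiece_of_mem (by omega) (SetLike.one_mem_graded 𝒬)

variable {Y X : Type u} [AddCommGroup Y] [Module Q Y] [AddCommGroup X] [Module R X]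
  {π : Y →ₛₗ[gradedToRingHom φ] X} {𝒴 : ℤ → AddSubgroup Y} {𝒳 : ℤ → AddSubgroup X}

theorem Reduction.gradedSMul (hφ : Function.Surjective φ) (h : GradedSMul 𝒬 𝒴)
    (hπ : Reduction φ π 𝒴 𝒳) : GradedSMul ℛ 𝒳 := by
  intro i j r x hr hx
  obtain ⟨a, ha, rfl⟩ := exists_mem_map_eq hφ hr
  obtain ⟨y, hy, rfl⟩ := hπ.surj j x hx
  have := hπ.mem _ _ (h i j a y ha hy)
  rwa [map_smulₛₗ] at this

/-- The map from the graded free module on a homogeneous basis, after extension of scalars. -/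
def HomogeneousBasis.coverRed (b : HomogeneousBasis (K := K) Q 𝒴)
    (π : Y →ₛₗ[gradedToRingHom φ] X) : (b.κ →₀ R) →ₗ[R] X :=
  Finsupp.linearCombination R fun c => π (b.v c)

theorem HomogeneousBasis.coverRed_freeReduction (b : HomogeneousBasis (K := K) Q 𝒴)
    (x : b.κ →₀ Q) : b.coverRed π (freeReduction φ b.κ x) = π (b.cover x) := by
  induction x using Finsupp.induction_linear with
  | zero => simp
  | add x y hx hy => simp only [map_add, hx, hy]
  | single c a =>
    rw [freeReduction_single, coverRed, Finsupp.linearCombination_single, cover_single,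
      map_smulₛₗ]
    rfl

/-- The grading of the kernel of `coverRed`. -/
def HomogeneousBasis.kerPieceRed (b : HomogeneousBasis (K := K) Q 𝒴)
    (π : Y →ₛₗ[gradedToRingHom φ] X) (j : ℤ) : AddSubgroup (LinearMap.ker (b.coverRed π)) :=
  (strandOf b.deg (ringPiece ℛ) j).comap (LinearMap.ker (b.coverRed π)).subtype.toAddMonoidHom

theorem HomogeneousBasis.strandExactRed (hφ : Function.Surjective φ) (h : GradedSMul 𝒬 𝒴)
    (hπ : Reduction φ π 𝒴 𝒳) (b : HomogeneousBasis (K := K) Q 𝒴) :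
    StrandExact (LinearMap.ker (b.coverRed π)).subtype (b.coverRed π) (b.kerPieceRed π)
      (strandOf b.deg (ringPiece ℛ)) 𝒳 where
  injective := Subtype.val_injective
  f_mem _ _ hx := hx
  g_mem j x hx := by
    obtain ⟨p, hp, rfl⟩ := (reduction_freeReduction hφ b.deg).surj j x hx
    rw [b.coverRed_freeReduction]
    exact hπ.mem _ _ (b.cover_mem h j p hp)
  surj j x hx := by
    obtain ⟨y, hy, rfl⟩ := hπ.surj j x hx
    obtain ⟨p, hp, rfl⟩ := b.cover_surj (𝒜 := 𝒬) j y hy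
    exact ⟨_, (reduction_freeReduction hφ b.deg).mem j p hp, b.coverRed_freeReduction p⟩
  ker _ y hy hy0 := ⟨⟨y, hy0⟩, hy, rfl⟩
  comp x := x.2

/-- Homogeneous elements of the kernel lift to homogeneous syzygies. -/
theorem HomogeneousBasis.exists_lift_ker (hφ : Function.Surjective φ)
    (h : GradedSMul 𝒬 𝒴) (hπ : Reduction φ π 𝒴 𝒳) (b : HomogeneousBasis (K := K) Q 𝒴)
    (j : ℤ) (x : LinearMap.ker (b.coverRed π)) (hx : x ∈ b.kerPieceRed π j) :
    ∃ y ∈ b.kerPiece 𝒬 j, freeReduction φ b.κ (y : b.κ →₀ Q) = x := by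
  have hred := reduction_freeReduction hφ (𝒬 := 𝒬) b.deg
  obtain ⟨p, hp, hpx⟩ := hred.surj j x hx
  have hx0 : b.coverRed π (x : b.κ →₀ R) = 0 := x.2
  rw [← hpx, b.coverRed_freeReduction] at hx0
  -- The lift `p` of `x` need not be a syzygy: its image only lies in `JY`. Such an image is also
  -- attained on an element of `J` times the free cover, which reduces to zero and can be subtracted
  -- from `p`.
  have key : ∀ l (y : Y), y ∈ smulPiece 𝒬 (RingHom.ker (gradedToRingHom φ)) 𝒴 l →
      ∃ p' ∈ strandOf b.deg (ringPiece 𝒬) l, freeReduction φ b.κ p' = 0 ∧ b.cover p' = y := by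
    intro l y hy
    induction hy using AddSubgroup.closure_induction with
    | mem y hy =>
      obtain ⟨i, a, haJ, ha, y, hy, rfl⟩ := hy
      obtain ⟨p', hp', rfl⟩ := b.cover_surj (𝒜 := 𝒬) _ y hy
      refine ⟨a • p', ?_, ?_, map_smul _ _ _⟩
      · have := (gradedSMul_ringPiece 𝒬).strandOf b.deg i _ a p' ha hp'
        rwa [add_sub_cancel] at this
      · rw [map_smulₛₗ, RingHom.mem_ker.1 haJ, zero_smul]
    | zero => exact ⟨0, zero_mem _, map_zero _, map_zero _⟩
    | add y y' _ _ hy hy' =>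
      obtain ⟨s, hs, hs0, rfl⟩ := hy
      obtain ⟨t, ht, ht0, rfl⟩ := hy'
      exact ⟨s + t, add_mem hs ht, by rw [map_add, hs0, ht0, add_zero], map_add _ _ _⟩
    | neg y _ hy =>
      obtain ⟨s, hs, hs0, rfl⟩ := hy
      exact ⟨-s, neg_mem hs, by rw [map_neg, hs0, neg_zero], map_neg _ _⟩
  obtain ⟨p', hp', hp0, hpp⟩ := key j _ (hπ.ker j _ (b.cover_mem h j p hp) hx0)
  refine ⟨⟨p - p', ?_⟩, sub_mem hp hp', ?_⟩
  · rw [LinearMap.mem_ker, map_sub, hpp, sub_self]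
  · change freeReduction φ b.κ (p - p') = _
    rw [map_sub, hp0, sub_zero, hpx]

/-- The extension of scalars of the syzygy module maps onto the syzygy module of the extension of
scalars, and the kernel is a graded vector space in high degrees. -/
theorem exists_syzygy (hφ : Function.Surjective φ)
    (hlow : ∀ i < 2, ∀ a ∈ 𝒬 i, φ a = 0 → a = 0) {C : FreeComplex 𝒬} {q : ℤ}
    (h : IsLinear C q 𝒴) (hπ : Reduction φ π 𝒴 𝒳) (b : HomogeneousBasis (K := K) Q 𝒴) :
    ∃ (X' : Type u) (_ : AddCommGroup X') (_ : Module R X') (𝒳' : ℤ → AddSubgroup X')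
      (π' : LinearMap.ker b.cover →ₛₗ[gradedToRingHom φ] X')
      (f : X' →ₗ[R] LinearMap.ker (b.coverRed π)) (ℋ : ℤ → AddSubgroup (LinearMap.ker f)),
      Reduction φ π' (b.kerPiece 𝒬) 𝒳' ∧
      StrandExact (LinearMap.ker f).subtype f ℋ 𝒳' (b.kerPieceRed π) ∧
      (∀ y, (f (π' y) : b.κ →₀ R) = freeReduction φ b.κ (y : b.κ →₀ Q)) ∧
      GradedSMul ℛ ℋ ∧
      (∀ r ∈ (HomogeneousIdeal.irrelevant ℛ).toIdeal, ∀ x : LinearMap.ker f, r • x = 0) ∧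
      ∀ j < q + 2, ∀ x ∈ ℋ j, x = 0 := by
  classical
  obtain ⟨X', i₁, i₂, π', hπ's, hπ'0⟩ :=
    exists_baseChange (gradedToRingHom φ) hφ (LinearMap.ker b.cover)
  let β : LinearMap.ker b.cover →ₛₗ[gradedToRingHom φ] LinearMap.ker (b.coverRed π) :=
    LinearMap.codRestrict _ ((freeReduction φ b.κ).comp (LinearMap.ker b.cover).subtype)
      fun y => by
        have hy : b.cover (y : b.κ →₀ Q) = 0 := y.2
        rw [LinearMap.mem_ker, LinearMap.comp_apply, Submodule.subtype_apply,
          b.coverRed_freeReduction, hy, map_zero]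
  have hβ : ∀ y, (β y : b.κ →₀ R) = freeReduction φ b.κ (y : b.κ →₀ Q) := fun _ => rfl
  have hβ0 : ∀ y, π' y = 0 → β y = 0 := fun y hy => by
    replace hy := (hπ'0 y).1 hy
    induction hy using Submodule.smul_induction_on' with
    | smul a ha y _ => rw [map_smulₛₗ, RingHom.mem_ker.1 ha, zero_smul]
    | add x _ y _ hx hy => rw [map_add, hx, hy, add_zero]
  obtain ⟨f, hf⟩ := exists_linearMap_of_surjective (φ := gradedToRingHom φ)
    (Y := LinearMap.ker b.cover) (Z := LinearMap.ker (b.coverRed π)) hφ π' hπ's β hβ0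
  have hgr := b.isGradedModule_kerPiece h.graded
  have hred : Reduction φ π' (b.kerPiece 𝒬) fun j => (b.kerPiece 𝒬 j).map π'.toAddMonoidHom :=
    { mem := fun j y hy => ⟨y, hy, rfl⟩
      surj := fun j x hx => hx
      ker := fun j y hy hy0 =>
        hgr.mem_smulPiece decompose_mem_ker hy ((hπ'0 y).1 hy0) }
  -- The kernel of `f` consists of the classes of syzygies with all coordinates in `J`.
  have hcoord : ∀ y : LinearMap.ker b.cover, f (π' y) = 0 → ∀ c, φ ((y : b.κ →₀ Q) c) = 0 := by
    intro y hy c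
    rw [hf] at hy
    rw [← freeReduction_apply, ← hβ, hy]
    rfl
  refine ⟨X', i₁, i₂, fun j => (b.kerPiece 𝒬 j).map π'.toAddMonoidHom, π', f,
    fun j => ((b.kerPiece 𝒬 j).map π'.toAddMonoidHom).comap
      (LinearMap.ker f).subtype.toAddMonoidHom, hred,
    ⟨Subtype.val_injective, fun _ _ hx => hx, ?_, ?_, fun _ y hy hy0 => ⟨⟨y, hy0⟩, hy, rfl⟩,
      fun x => x.2⟩, fun y => by rw [hf, hβ], ?_, ?_, ?_⟩
  · rintro j _ ⟨y, hy, rfl⟩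
    change f (π' y) ∈ _
    rw [hf]
    exact (reduction_freeReduction hφ b.deg).mem j _ hy
  · intro j x hx
    obtain ⟨y, hy, hyx⟩ := b.exists_lift_ker hφ h.graded.smul_mem hπ j x hx
    refine ⟨π' y, ⟨y, hy, rfl⟩, Subtype.ext ?_⟩
    rw [hf, hβ, hyx]
  · intro i j r x hr hx
    exact hred.gradedSMul hφ hgr.smul_mem i j r x hr hx
  · rintro r hr ⟨x, hx⟩
    obtain ⟨a, ha, rfl⟩ := exists_mem_irrelevant_map_eq hφ hr
    obtain ⟨y, rfl⟩ := hπ's x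
    -- Here `a • y = u y`, and `u` is defined on the whole free cover, where `y` is a combination of
    -- basis vectors with coefficients in `J`. Hence `u y` lies in `J` times the syzygy module.
    obtain ⟨u, hu⟩ := h.exists_section b a ha
    apply Subtype.ext
    change gradedToRingHom φ a • π' y = 0
    rw [← map_smulₛₗ, hπ'0, ← hu, ← Finsupp.sum_single (y : b.κ →₀ Q), Finsupp.sum, map_sum]
    refine Submodule.sum_mem _ fun c _ => ?_
    have : Finsupp.single c ((y : b.κ →₀ Q) c) =
        (y : b.κ →₀ Q) c • Finsupp.single c (1 : Q) := by simp
    rw [this, map_smul]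
    exact Submodule.smul_mem_smul (hcoord y hx c) Submodule.mem_top
  · rintro j hj ⟨x, hx⟩ ⟨y, hy, hyx⟩
    change π' y = x at hyx
    subst hyx
    -- The coordinates of `y` lie in `J` and have degree `j - deg c < 2`, as the basis starts in
    -- degree `q`.
    have hy0 : y = 0 := by
      apply Subtype.ext
      ext c
      obtain h0 | ⟨i, hi, ha⟩ := mem_ringPiece (hy c)
      · exact h0
      · have := b.le_deg h.low c
        exact hlow i (by omega) _ ha (hcoord y hx c)
    apply Subtype.ext
    change π' y = 0
    rw [hy0, map_zero]

end Syzygy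

/-! ### Diagram chases and the induction on homological degree. -/

section Induction

variable {Q R : Type u} [CommRing Q] [Algebra K Q] [CommRing R] [Algebra K R]
  {𝒬 : ℕ → Submodule K Q} {ℛ : ℕ → Submodule K R} [GradedAlgebra 𝒬] [GradedAlgebra ℛ]
  {φ : 𝒬 →ₐᵍ[K] ℛ} {C : FreeComplex 𝒬} {D : FreeComplex ℛ}
  {Y X : Type u} [AddCommGroup Y] [Module Q Y] [AddCommGroup X] [Module R X]
  {π : Y →ₛₗ[gradedToRingHom φ] X} {𝒴 : ℤ → AddSubgroup Y} {𝒳 : ℤ → AddSubgroup X}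

theorem Comparison.push_map (H : Comparison φ C D) {Y' X' : Type u} [AddCommGroup Y']
    [Module Q Y'] [AddCommGroup X'] [Module R X'] (π' : Y' →ₛₗ[gradedToRingHom φ] X') (f : Y' →ₗ[Q] Y) (f' : X' →ₗ[R] X)
    (hf : ∀ y, f' (π' y) = π (f y)) {n : ℕ} (x : C.ι n →₀ Y') :
    push id f'.toAddMonoidHom (H.map π' n x) = H.map π n (push id f.toAddMonoidHom x) := by
  rw [Comparison.map, Comparison.map, push_push, push_push]
  congr 2
  ext y
  exact hf y

/-- Vanishing of the first homology descends along the reduction. -/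
theorem Comparison.vanishes_one (H : Comparison φ C D) {Y' P P' B : Type u}
    [AddCommGroup Y'] [Module Q Y'] [AddCommGroup P] [Module Q P] [AddCommGroup P'] [Module R P']
    [AddCommGroup B] [Module R B] {𝒴' : ℤ → AddSubgroup Y'} {𝒱 : ℤ → AddSubgroup P}
    {𝒱' : ℤ → AddSubgroup P'} {ℬ : ℤ → AddSubgroup B} {i : Y' →ₗ[Q] P} {p : P →ₗ[Q] Y}
    {i' : B →ₗ[R] P'} {p' : P' →ₗ[R] X} {ρ : P →ₛₗ[gradedToRingHom φ] P'}
    (hE : StrandExact i p 𝒴' 𝒱 𝒴) (hE' : StrandExact i' p' ℬ 𝒱' 𝒳) (hP : GradedSMul 𝒬 𝒱)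
    (hP' : GradedSMul ℛ 𝒱') (hρ : Reduction φ ρ 𝒱 𝒱') (hpρ : ∀ x, p' (ρ x) = π (p x))
    (hlift : ∀ j, ∀ x ∈ ℬ j, ∃ y ∈ 𝒴' j, ρ (i y) = i' x) {j : ℤ}
    (hvP' : D.Vanishes 𝒱' 1 j) (hv : C.Vanishes 𝒴 1 j) : D.Vanishes 𝒳 1 j := by
  intro z hz hzc
  obtain ⟨w, hw, rfl⟩ := hE'.exists_push_g hz
  have hzc' : act (D.e 0) (push id p'.toAddMonoidHom w) = 0 := hzc
  obtain ⟨x, hx, hxw⟩ := hE'.exists_push_f (act_mem_strandOf hP' (D.e_mem 0) hw)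
    (by rw [← act_push_id, hzc'])
  -- The image of the cycle under the connecting map has coefficients in `ℬ`; it lifts to
  -- coefficients in the syzygies over `Q`.
  obtain ⟨y, hy, hyw⟩ : ∃ y ∈ strandOf (C.deg 0) 𝒴' j,
      H.map ρ 0 (push id i.toAddMonoidHom y) = act (D.e 0) w := by
    obtain ⟨y, hy, hyx⟩ := exists_push_eq (𝒴 := 𝒴') (H.deg_eq 0) H.g_zero_bijective.2
      (𝒳 := fun l => (ℬ l).map i'.toAddMonoidHom)
      (f := ρ.toAddMonoidHom.comp i.toAddMonoidHom)
      (fun l t ht => by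
        obtain ⟨s, hs, rfl⟩ := ht
        exact hlift l s hs)
      (x := act (D.e 0) w) (j := j) (by
        rw [← hxw]
        exact push_mem_strandOf (𝒳 := fun l => (ℬ l).map i'.toAddMonoidHom) (fun _ => rfl)
          (fun l t ht => ⟨t, ht, rfl⟩) hx)
    refine ⟨y, hy, ?_⟩
    rw [← hyx, Comparison.map, push_push]
    rfl
  -- With coefficients in the free module, `y` bounds over `R`, hence over `Q` by injectivity in
  -- homological degree zero. Vanishing of the first homology of `Y` then makes `y` itself a
  -- boundary.
  obtain ⟨t, ht, hty⟩ := H.injectiveAt_zero hP hρ j _ (hE.push_f_mem hy) trivial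
    ⟨w, hw, hyw.symm⟩
  obtain ⟨v, hv, hvt⟩ := hv _ (hE.push_g_mem ht) (by
    change act (C.e 0) _ = 0
    rw [act_push_id, hty, hE.push_comp])
  obtain ⟨v', hv', rfl⟩ := hE.exists_push_g hv
  obtain ⟨u, hu, hut⟩ := hE.exists_push_f (sub_mem ht (act_mem_strandOf hP (C.e_mem 1) hv'))
    (by rw [map_sub, ← act_push_id, hvt, sub_self])
  have huy : act (C.e 0) u = y := by
    refine hE.push_injective ?_
    rw [← act_push_id, hut, map_sub, hty, act_act _ _ (C.act_e 0), sub_zero]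
  -- Subtracting the image of `u` turns `w` into a cycle with free coefficients, which bounds; the
  -- correction dies in `X`.
  obtain ⟨s, hs, hsw⟩ := hvP' (w - H.map ρ 1 (push id i.toAddMonoidHom u))
    (sub_mem hw (H.map_mem hρ (hE.push_f_mem hu))) (by
      change act (D.e 0) _ = 0
      rw [map_sub, H.act_map, act_push_id, huy, hyw, sub_self])
  refine ⟨_, hE'.push_g_mem hs, ?_⟩
  rw [act_push_id, hsw, map_sub, H.push_map ρ p p' hpρ, hE.push_comp, map_zero, sub_zero]

/-- The dimension shift in the comparison of homologies. -/
theorem Comparison.injectiveAt_succ (H : Comparison φ C D) {Y' P P' B X' Z : Type u}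
    [AddCommGroup Y'] [Module Q Y'] [AddCommGroup P] [Module Q P] [AddCommGroup P'] [Module R P']
    [AddCommGroup B] [Module R B] [AddCommGroup X'] [Module R X'] [AddCommGroup Z] [Module R Z]
    {𝒴' : ℤ → AddSubgroup Y'} {𝒱 : ℤ → AddSubgroup P} {𝒱' : ℤ → AddSubgroup P'}
    {ℬ : ℤ → AddSubgroup B} {𝒳' : ℤ → AddSubgroup X'} {ℋ : ℤ → AddSubgroup Z}
    {i : Y' →ₗ[Q] P} {p : P →ₗ[Q] Y} {i' : B →ₗ[R] P'} {p' : P' →ₗ[R] X}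
    {k : Z →ₗ[R] X'} {f : X' →ₗ[R] B} {ρ : P →ₛₗ[gradedToRingHom φ] P'}
    {π' : Y' →ₛₗ[gradedToRingHom φ] X'}
    (hE : StrandExact i p 𝒴' 𝒱 𝒴) (hE' : StrandExact i' p' ℬ 𝒱' 𝒳)
    (hf : StrandExact k f ℋ 𝒳' ℬ) (hP : GradedSMul 𝒬 𝒱) (hP' : GradedSMul ℛ 𝒱')
    (h𝒳' : GradedSMul ℛ 𝒳') (hρ : Reduction φ ρ 𝒱 𝒱') (hπ' : Reduction φ π' 𝒴' 𝒳')
    (hpρ : ∀ x, p' (ρ x) = π (p x)) (hfπ : ∀ y, i' (f (π' y)) = ρ (i y)) {n : ℕ} {j : ℤ}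
    (hvP : C.Vanishes 𝒱 (n + 1) j) (hℋ : D.Vanishes ℋ n j) (hi : H.InjectiveAt π' 𝒴' 𝒳' n j) :
    H.InjectiveAt π 𝒴 𝒳 (n + 1) j := by
  rintro z hz hzc ⟨w, hw, hwz⟩
  have hnat : ∀ x : C.ι n →₀ Y', push id i'.toAddMonoidHom
      (push id f.toAddMonoidHom (H.map π' n x)) = H.map ρ n (push id i.toAddMonoidHom x) := by
    intro x
    rw [← H.push_map π' i (i' ∘ₗ f) hfπ x, push_push]
    rfl
  obtain ⟨t, ht, rfl⟩ := hE.exists_push_g hz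
  have hzc' : act (C.e n) (push id p.toAddMonoidHom t) = 0 := hzc
  rw [act_push_id] at hzc'
  -- `y` represents the image of `z` under the connecting map to the homology of the syzygy.
  obtain ⟨y, hy, hyt⟩ := hE.exists_push_f (act_mem_strandOf hP (C.e_mem n) ht) hzc'
  obtain ⟨w', hw', rfl⟩ := hE'.exists_push_g hw
  rw [act_push_id] at hwz
  -- Over `R`, the image of `t` and the boundary of `w'` agree in `X`, so they differ by a chain in
  -- `B`, which lifts to `X'`.
  obtain ⟨x, hx, hxw⟩ := hE'.exists_push_f
    (sub_mem (H.map_mem hρ ht) (act_mem_strandOf hP' (D.e_mem (n + 1)) hw'))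
    (by rw [map_sub, H.push_map ρ p p' hpρ, hwz, sub_self])
  obtain ⟨x', hx', rfl⟩ := hf.exists_push_g hx
  have hxy : push id f.toAddMonoidHom (H.map π' n y - act (D.e n) x') = 0 := by
    refine hE'.push_injective ?_
    rw [map_sub, map_sub, hnat, hyt, ← act_push_id, ← act_push_id, hxw, map_sub, H.act_map,
      act_act _ _ (D.act_e n), sub_zero, sub_self, map_zero]
  -- The image of `y` and the boundary of `x'` agree in `B`, so they differ by a cycle with
  -- coefficients in `ℋ`. This cycle bounds by `hℋ`, so the image of `y` bounds in `X'` and `hi`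
  -- applies.
  obtain ⟨s, hs, hsx⟩ := hf.exists_push_f
    (sub_mem (H.map_mem hπ' hy) (act_mem_strandOf h𝒳' (D.e_mem n) hx')) hxy
  have hyc : C.IsCycle n y := hE.isCycle_of_push C (hyt ▸ C.isCycle_act n t)
  obtain ⟨r, hr, rfl⟩ := hℋ s hs (hf.isCycle_of_push D (by
    rw [hsx]
    exact FreeComplex.IsCycle.sub D (H.isCycle_map hyc) (D.isCycle_act n x')))
  obtain ⟨u, hu, rfl⟩ := hi y hy hyc ⟨_, add_mem (hf.push_f_mem hr) hx', by
    rw [map_add, act_push_id, hsx, sub_add_cancel]⟩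
  -- Since `y` is the boundary of `u`, the lift `t` can be corrected to a cycle with free
  -- coefficients without changing its image `z`.
  obtain ⟨v, hv, hvt⟩ := hvP (t - push id i.toAddMonoidHom u)
    (sub_mem ht (hE.push_f_mem hu)) (by
      change act (C.e n) _ = 0
      rw [map_sub, act_push_id, hyt, sub_self])
  refine ⟨_, hE.push_g_mem hv, ?_⟩
  rw [act_push_id, hvt, map_sub, hE.push_comp, sub_zero]

theorem Comparison.vanishes_zero (H : Comparison φ C D) (hπ : Reduction φ π 𝒴 𝒳) {j : ℤ} (hv : C.Vanishes 𝒴 0 j) :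
    D.Vanishes 𝒳 0 j := by
  rintro z hz -
  obtain ⟨y, hy, rfl⟩ := exists_push_eq (H.deg_eq 0) H.g_zero_bijective.2
    (f := π.toAddMonoidHom) hπ.surj hz
  obtain ⟨w, hw, rfl⟩ := hv y hy trivial
  exact ⟨_, H.map_mem hπ hw, H.act_map π 0 w⟩

/-- Vanishing below the diagonal descends along the reduction, and the comparison of homologies
is injective on and below the diagonal. -/
theorem Comparison.vanishes_and_injectiveAt (H : Comparison φ C D) (hφ : Function.Surjective φ)
    (h0 : ∀ a ∈ 𝒬 0, ∃ c : K, algebraMap K Q c = a)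
    (hlow : ∀ i < 2, ∀ a ∈ 𝒬 i, φ a = 0 → a = 0)
    (hk : IsLinear C 0 (residuePiece 𝒬)) (hk0 : ∀ j < 0, C.Vanishes (residuePiece 𝒬) 0 j)
    {π₀ : Residue 𝒬 →ₛₗ[gradedToRingHom φ] Residue ℛ}
    (hπ₀ : Reduction φ π₀ (residuePiece 𝒬) (residuePiece ℛ)) (n : ℕ) :
    ∀ {Y X : Type u} [AddCommGroup Y] [Module Q Y] [AddCommGroup X] [Module R X]
      {π : Y →ₛₗ[gradedToRingHom φ] X} {𝒴 : ℤ → AddSubgroup Y} {𝒳 : ℤ → AddSubgroup X} {q : ℤ},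
      IsLinear C q 𝒴 → Reduction φ π 𝒴 𝒳 →
      (n ≠ 0 → ∀ j < n + q, D.Vanishes 𝒳 n j) ∧ ∀ j ≤ n + q, H.InjectiveAt π 𝒴 𝒳 n j := by
  have h0R : ∀ r ∈ ℛ 0, ∃ c : K, algebraMap K R c = r := by
    intro r hr
    obtain ⟨a, ha, rfl⟩ := exists_mem_map_eq hφ hr
    obtain ⟨c, rfl⟩ := h0 a ha
    exact ⟨c, (AlgHomClass.commutes φ c).symm⟩
  induction n using Nat.strong_induction_on with
  | _ n ih =>
    intro Y X _ _ _ _ π 𝒴 𝒳 q h hπ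
    cases n with
    -- No vanishing is claimed in homological degree zero: the resolved module need not be bounded
    -- below, so it can fail there for general coefficients.
    | zero => exact ⟨fun h => absurd rfl h, fun j _ => H.injectiveAt_zero h.graded.smul_mem hπ j⟩
    | succ n =>
      -- The induction hypothesis for `k` itself gives the vanishing below the diagonal over `R`
      -- that controls `ℋ`.
      have hkR : ∀ m < n + 1, ∀ j < (m : ℤ), D.Vanishes (residuePiece ℛ) m j := by
        intro m hm j hj
        cases m with
        | zero => exact H.vanishes_zero hπ₀ (hk0 j (by simpa using hj))
        | succ m => exact (ih (m + 1) hm hk hπ₀).1 (Nat.succ_ne_zero m) j (by simpa using hj)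
      obtain ⟨b⟩ := exists_homogeneousBasis 𝒬 h.graded.smul_mem
      obtain ⟨X', i₁, i₂, 𝒳', π', f, ℋ, hπ', hf, hfπ, hℋ, hkill, hℋlow⟩ :=
        exists_syzygy hφ hlow h hπ b
      have hE := b.strandExact h.graded.smul_mem
      have hE' := b.strandExactRed hφ h.graded.smul_mem hπ
      have hρ := reduction_freeReduction (𝒬 := 𝒬) hφ b.deg
      have hP := (gradedSMul_ringPiece 𝒬).strandOf b.deg
      have hP' := (gradedSMul_ringPiece ℛ).strandOf b.deg
      have hlin := h.kerPiece H.exact_source h0 b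
      have h𝒳' := hπ'.gradedSMul hφ hlin.graded.smul_mem
      -- `ℋ` starts in degree `q + 2`. Thus for `m = n` the bound covers `j ≤ n + 1 + q`, as
      -- injectivity in degree `n + 1` requires; for vanishing, where two homological degrees are
      -- lost, the two extra internal degrees just suffice.
      have hvH : ∀ m < n + 1, ∀ j < (m : ℤ) + (q + 2), D.Vanishes ℋ m j := fun m hm =>
        FreeComplex.Vanishes.of_residue D h0R hℋ hkill hℋlow (hkR m hm)
      refine ⟨fun _ j hj => ?_, fun j hj => ?_⟩
      · cases n with
        | zero =>
          -- The general argument would need `Tor^R_0` of `X'` to vanish, which the induction does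
          -- not provide.
          exact H.vanishes_one hE hE' hP hP' hρ b.coverRed_freeReduction
            (b.exists_lift_ker hφ h.graded.smul_mem hπ)
            (FreeComplex.Vanishes.cover (H.exact_target 0) b.deg) (h.vanishes 0 j hj)
        | succ n =>
          refine hE'.vanishes_right D hP'
            (FreeComplex.Vanishes.cover (H.exact_target (n + 1)) b.deg) ?_
          refine hf.vanishes_right D h𝒳'
            ((ih (n + 1) (by omega) hlin hπ').1 (Nat.succ_ne_zero n) j ?_)
            (hvH n (by omega) j ?_)
          · push_cast at hj ⊢
            omega
          · push_cast at hj ⊢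
            omega
      · refine H.injectiveAt_succ hE hE' hf hP hP' h𝒳' hρ hπ' b.coverRed_freeReduction hfπ
          (FreeComplex.Vanishes.cover (H.exact_source n) b.deg) (hvH n (by omega) j ?_)
          ((ih n (by omega) hlin hπ').2 j ?_)
        · push_cast at hj ⊢
          omega
        · push_cast at hj ⊢
          omega

end Induction

/-! ## The standard resolution -/

section Standard

variable {A : Type u} [CommRing A] [Algebra K A] (𝒜 : ℕ → Submodule K A) [GradedAlgebra 𝒜]
  {N : Type u} [AddCommGroup N] [Module A N] (𝒩 : ℤ → AddSubgroup N)

/-- The standard resolution as a complex of graded free modules. -/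
def resolution : FreeComplex 𝒜 where
  ι n := (stage 𝒜 𝒩 n).ι
  deg n := (stage 𝒜 𝒩 n).deg
  e n := fun b : (stage 𝒜 𝒩 n).Gen 𝒜 => b.2.1
  e_mem n := fun b : (stage 𝒜 𝒩 n).Gen 𝒜 => b.2.2.2
  act_e n := fun b : (stage 𝒜 𝒩 (n + 1)).Gen 𝒜 => (act_self _ _).trans b.2.2.1

omit [GradedAlgebra 𝒜] in
theorem act_resolution (n : ℕ) (x : F 𝒜 𝒩 (n + 1)) :
    act ((resolution 𝒜 𝒩).e n) x = d 𝒜 𝒩 n x :=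
  act_self _ _

/-- A homogeneous cycle is itself a basis element of the next step, and the differential sends that
basis element to the cycle. -/
theorem resolution_vanishes (n : ℕ) (j : ℤ) :
    (resolution 𝒜 𝒩).Vanishes (ringPiece 𝒜) (n + 1) j := by
  intro z hz hzc
  have hzc' : d 𝒜 𝒩 n z = 0 := (act_resolution 𝒜 𝒩 n z).symm.trans hzc
  let b : (stage 𝒜 𝒩 (n + 1)).Gen 𝒜 := ⟨j, z, hzc', hz⟩
  refine ⟨Finsupp.single (show (resolution 𝒜 𝒩).ι (n + 2) from b) 1,
    single_mem_strandOf (mem_ringPiece_of_mem (i := 0) ?_ (SetLike.one_mem_graded 𝒜)), ?_⟩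
  · change (0 : ℤ) = j - j
    rw [sub_self]
  · rw [act_self, Finsupp.linearCombination_single, one_smul]
    rfl

variable {𝒜 𝒩}

/-- Coefficients in a module in degrees at least `q` give homology in degrees at least `n + q`, if
the resolved module lives in nonnegative degrees. -/
theorem resolution_vanishes_of_low (h0 : ∀ a ∈ 𝒜 0, ∃ c : K, algebraMap K A c = a)
    (hN : ∀ j < 0, ∀ x ∈ 𝒩 j, x = 0) (n : ℕ) :
    ∀ {Y : Type u} [AddCommGroup Y] [Module A Y] {𝒴 : ℤ → AddSubgroup Y} {q : ℤ},
      IsGradedModule 𝒜 𝒴 → (∀ j < q, ∀ y ∈ 𝒴 j, y = 0) →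
      ∀ j < n + q, (resolution 𝒜 𝒩).Vanishes 𝒴 n j := by
  classical
  induction n with
  | zero =>
    rintro Y _ _ 𝒴 q - hq j hj z hz -
    have key : ∀ b : (resolution 𝒜 𝒩).ι 0, ∃ w ∈ strandOf ((resolution 𝒜 𝒩).deg 1) 𝒴 j,
        act ((resolution 𝒜 𝒩).e 0) w = Finsupp.single b (z b) := by
      intro b
      let b' : Σ j : ℤ, 𝒩 j := b
      have hzb : z b ∈ 𝒴 (j - b'.1) := hz b
      by_cases hb : 0 ≤ b'.1
      · refine ⟨0, zero_mem _, ?_⟩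
        rw [hq _ (by push_cast at hj; omega) _ hzb, map_zero, Finsupp.single_zero]
      -- A basis element of negative degree stands for the zero element of `N`. The basis vector is
      -- then a relation, so it bounds.
      · have hb0 : (b'.2 : N) = 0 := hN _ (not_le.1 hb) _ b'.2.2
        let c : (stage 𝒜 𝒩 0).Gen 𝒜 := ⟨b'.1, Finsupp.single b 1, by
          change augmentation A 𝒩 (Finsupp.single b' 1) = 0
          rw [augmentation, Finsupp.linearCombination_single, hb0, smul_zero],
          single_mem_strandOf (𝒳 := ringPiece 𝒜) (mem_ringPiece_of_mem (i := 0) (by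
            change (0 : ℤ) = b'.1 - b'.1
            rw [sub_self]) (SetLike.one_mem_graded 𝒜))⟩
        refine ⟨Finsupp.single (show (resolution 𝒜 𝒩).ι 1 from c) (z b),
          single_mem_strandOf hzb, ?_⟩
        rw [act_single]
        change push id _ (Finsupp.single b (1 : A)) = _
        rw [push_single]
        simp
    choose w hw hwz using key
    refine ⟨∑ b ∈ z.support, w b, AddSubgroup.sum_mem _ fun b _ => hw b, ?_⟩
    rw [map_sum]
    conv_rhs => rw [← Finsupp.sum_single z]
    exact Finset.sum_congr rfl fun b _ => hwz b
  | succ n ih =>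
    intro Y _ _ 𝒴 q h hq j hj
    obtain ⟨b⟩ := exists_homogeneousBasis 𝒜 h.smul_mem
    -- Dimension shift: the syzygy starts in degree `q + 1`, which makes up for the drop in
    -- homological degree.
    refine (b.strandExact h.smul_mem).vanishes_right _
      ((gradedSMul_ringPiece 𝒜).strandOf b.deg)
      (FreeComplex.Vanishes.cover (resolution_vanishes 𝒜 𝒩 n) b.deg)
      (ih (b.isGradedModule_kerPiece h) (b.kerPiece_eq_zero h0 hq) j ?_)
    push_cast at hj
    omega

/-! ### Tor through coefficients in the residue field -/

/-- The reduction of coefficients modulo elements of positive degree. -/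
def toResidue (𝒜 : ℕ → Submodule K A) [GradedAlgebra 𝒜] : A →ₗ[A] Residue 𝒜 :=
  Submodule.mkQ (HomogeneousIdeal.irrelevant 𝒜).toIdeal

/-- This identifies `F / A_+ F` with the finitely supported vectors over `k`, so that Tor becomes
the homology of the resolution with coefficients in `k`. -/
theorem mem_plus_iff {ι : Type u} (x : ι →₀ A) :
    x ∈ plus 𝒜 ι ↔ push id (toResidue 𝒜).toAddMonoidHom x = 0 := by
  classical
  have hz : ∀ a : A, toResidue 𝒜 a = 0 ↔ a ∈ (HomogeneousIdeal.irrelevant 𝒜).toIdeal :=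
    fun a => Submodule.Quotient.mk_eq_zero _
  constructor
  · intro hx
    change x ∈ (HomogeneousIdeal.irrelevant 𝒜).toIdeal • (⊤ : Submodule A (ι →₀ A)) at hx
    induction hx using Submodule.smul_induction_on' with
    | smul a ha y _ =>
      ext b
      rw [push_id_apply]
      exact (hz _).2 (Ideal.mul_mem_right _ _ ha)
    | add x _ y _ hx hy => rw [map_add, hx, hy, add_zero]
  · intro hx
    change x ∈ (HomogeneousIdeal.irrelevant 𝒜).toIdeal • (⊤ : Submodule A (ι →₀ A))
    rw [← Finsupp.sum_single x]
    refine Submodule.sum_mem _ fun b _ => ?_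
    have hb : toResidue 𝒜 (x b) = 0 := by
      have := DFunLike.congr_fun hx b
      rwa [push_id_apply] at this
    have hs : Finsupp.single b (x b) = x b • Finsupp.single b (1 : A) := by simp
    rw [hs]
    exact Submodule.smul_mem_smul ((hz _).1 hb) Submodule.mem_top

theorem mkQ_plus_eq_iff {ι : Type u} (x y : ι →₀ A) :
    (plus 𝒜 ι).mkQ x = (plus 𝒜 ι).mkQ y ↔
      push id (toResidue 𝒜).toAddMonoidHom x = push id (toResidue 𝒜).toAddMonoidHom y := by
  rw [← sub_eq_zero, ← map_sub, Submodule.mkQ_apply, Submodule.Quotient.mk_eq_zero, mem_plus_iff,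
    map_sub, sub_eq_zero]

theorem toResidue_mem (j : ℤ) (a : A) (ha : a ∈ ringPiece 𝒜 j) :
    toResidue 𝒜 a ∈ residuePiece 𝒜 j := by
  obtain rfl | ⟨i, rfl, ha⟩ := mem_ringPiece ha
  · rw [map_zero]
    exact zero_mem _
  · unfold residuePiece
    split_ifs with hi
    · trivial
    · rw [AddSubgroup.mem_bot]
      exact (Submodule.Quotient.mk_eq_zero _).2
        (HomogeneousIdeal.mem_irrelevant_of_mem 𝒜 (by omega) ha)

theorem exists_toResidue_eq (h0 : ∀ a ∈ 𝒜 0, ∃ c : K, algebraMap K A c = a) (j : ℤ)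
    (x : Residue 𝒜) (hx : x ∈ residuePiece 𝒜 j) : ∃ a ∈ ringPiece 𝒜 j, toResidue 𝒜 a = x := by
  unfold residuePiece at hx
  split_ifs at hx with hj
  · obtain ⟨t, rfl⟩ := exists_algebraMap_eq_residue h0 x
    exact ⟨algebraMap K A t, mem_ringPiece_of_mem (i := 0) (by simp [hj])
      (SetLike.algebraMap_mem_graded 𝒜 t), rfl⟩
  · rw [AddSubgroup.mem_bot] at hx
    exact ⟨0, zero_mem _, by rw [hx, map_zero]⟩

theorem push_toResidue_mem {n : ℕ} {j : ℤ} {y : F 𝒜 𝒩 n}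
    (hy : y ∈ freePiece 𝒜 (stage 𝒜 𝒩 n).deg j) :
    push id (toResidue 𝒜).toAddMonoidHom y ∈
      strandOf ((resolution 𝒜 𝒩).deg n) (residuePiece 𝒜) j :=
  push_mem_strandOf (𝒴 := ringPiece 𝒜) (fun _ => rfl) toResidue_mem hy

theorem exists_push_toResidue_eq (h0 : ∀ a ∈ 𝒜 0, ∃ c : K, algebraMap K A c = a) {n : ℕ} {j : ℤ}
    {x : (resolution 𝒜 𝒩).ι n →₀ Residue 𝒜}
    (hx : x ∈ strandOf ((resolution 𝒜 𝒩).deg n) (residuePiece 𝒜) j) :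
    ∃ y : F 𝒜 𝒩 n, y ∈ freePiece 𝒜 (stage 𝒜 𝒩 n).deg j ∧
      push id (toResidue 𝒜).toAddMonoidHom y = x := by
  obtain ⟨y, hy, hyx⟩ := exists_push_eq (𝒴 := ringPiece 𝒜) (f := (toResidue 𝒜).toAddMonoidHom)
    (deg := (resolution 𝒜 𝒩).deg n) (fun _ => rfl) Function.surjective_id
    (exists_toResidue_eq h0) hx
  exact ⟨y, hy, hyx⟩

theorem push_toResidue_d (n : ℕ) (y : F 𝒜 𝒩 (n + 1)) :
    push id (toResidue 𝒜).toAddMonoidHom (d 𝒜 𝒩 n y) =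
      act ((resolution 𝒜 𝒩).e n) (push id (toResidue 𝒜).toAddMonoidHom y) :=
  ((act_push_id _ _ _).trans (congrArg _ (act_resolution 𝒜 𝒩 n y))).symm

theorem mkQ_mem_cycles_iff {n : ℕ} {j : ℤ} {y : F 𝒜 𝒩 n}
    (hy : y ∈ freePiece 𝒜 (stage 𝒜 𝒩 n).deg j) :
    (plus 𝒜 (stage 𝒜 𝒩 n).ι).mkQ y ∈ cycles 𝒜 𝒩 n j ↔
      (resolution 𝒜 𝒩).IsCycle n (push id (toResidue 𝒜).toAddMonoidHom y) := by
  cases n with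
  | zero => exact ⟨fun _ => trivial, fun _ => ⟨y, hy, rfl⟩⟩
  | succ n =>
    have h1 : dbar 𝒜 𝒩 n ((plus 𝒜 (stage 𝒜 𝒩 (n + 1)).ι).mkQ y) =
        (plus 𝒜 (stage 𝒜 𝒩 n).ι).mkQ (d 𝒜 𝒩 n y) := rfl
    have h2 : dbar 𝒜 𝒩 n ((plus 𝒜 (stage 𝒜 𝒩 (n + 1)).ι).mkQ y) = 0 ↔
        act ((resolution 𝒜 𝒩).e n) (push id (toResidue 𝒜).toAddMonoidHom y) = 0 := by
      rw [h1, ← map_zero (plus 𝒜 (stage 𝒜 𝒩 n).ι).mkQ, mkQ_plus_eq_iff, map_zero,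
        push_toResidue_d]
      rfl
    exact ⟨fun h => h2.1 h.2, fun h => ⟨⟨y, hy, rfl⟩, h2.2 h⟩⟩

theorem mkQ_mem_boundaries_iff (h0 : ∀ a ∈ 𝒜 0, ∃ c : K, algebraMap K A c = a) {n : ℕ} {j : ℤ}
    (y : F 𝒜 𝒩 n) :
    (plus 𝒜 (stage 𝒜 𝒩 n).ι).mkQ y ∈ boundaries 𝒜 𝒩 n j ↔
      ∃ w ∈ strandOf ((resolution 𝒜 𝒩).deg (n + 1)) (residuePiece 𝒜) j,
        act ((resolution 𝒜 𝒩).e n) w = push id (toResidue 𝒜).toAddMonoidHom y := by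
  have h1 : ∀ w : F 𝒜 𝒩 (n + 1), dbar 𝒜 𝒩 n ((plus 𝒜 (stage 𝒜 𝒩 (n + 1)).ι).mkQ w) =
      (plus 𝒜 (stage 𝒜 𝒩 n).ι).mkQ y ↔
      act ((resolution 𝒜 𝒩).e n) (push id (toResidue 𝒜).toAddMonoidHom w) =
        push id (toResidue 𝒜).toAddMonoidHom y := by
    intro w
    change (plus 𝒜 (stage 𝒜 𝒩 n).ι).mkQ (d 𝒜 𝒩 n w) = _ ↔ _
    rw [mkQ_plus_eq_iff, push_toResidue_d]
    rfl
  constructor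
  · rintro ⟨_, ⟨w, hw, rfl⟩, hwy⟩
    exact ⟨_, push_toResidue_mem hw, (h1 w).1 hwy⟩
  · rintro ⟨w, hw, hwy⟩
    obtain ⟨w', hw', rfl⟩ := exists_push_toResidue_eq h0 hw
    exact ⟨_, ⟨w', hw', rfl⟩, (h1 w').2 hwy⟩

theorem exists_mkQ_eq_of_mem_cycles {n : ℕ} {j : ℤ} {x : Fbar 𝒜 𝒩 n} (hx : x ∈ cycles 𝒜 𝒩 n j) :
    ∃ y ∈ freePiece 𝒜 (stage 𝒜 𝒩 n).deg j, (plus 𝒜 (stage 𝒜 𝒩 n).ι).mkQ y = x := by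
  cases n with
  | zero => exact hx
  | succ n => exact hx.1

theorem vanishes_of_subsingleton_tor (h0 : ∀ a ∈ 𝒜 0, ∃ c : K, algebraMap K A c = a) {n : ℕ}
    {j : ℤ} (h : Subsingleton (Tor 𝒜 𝒩 n j)) :
    (resolution 𝒜 𝒩).Vanishes (residuePiece 𝒜) n j := by
  intro z hz hzc
  obtain ⟨y, hy, rfl⟩ := exists_push_toResidue_eq h0 hz
  have hc := (mkQ_mem_cycles_iff hy).2 hzc
  have hb := (Submodule.Quotient.mk_eq_zero _).1
    (h.elim (Submodule.Quotient.mk (⟨_, hc⟩ : cycles 𝒜 𝒩 n j)) 0)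
  exact (mkQ_mem_boundaries_iff h0 y).1 hb

end Standard

/-! ### Comparison of the standard resolutions over source and target. -/

section StandardComparison

variable {Q R : Type u} [CommRing Q] [Algebra K Q] [CommRing R] [Algebra K R]
  {𝒬 : ℕ → Submodule K Q} {ℛ : ℕ → Submodule K R} [GradedAlgebra 𝒬] [GradedAlgebra ℛ]
  {φ : 𝒬 →ₐᵍ[K] ℛ} {N N' : Type u} [AddCommGroup N] [Module Q N] [AddCommGroup N'] [Module R N']
  {𝒩 : ℤ → AddSubgroup N} {𝒩' : ℤ → AddSubgroup N'}

theorem freeMap_eq_push {ι ι' : Type u} (g : ι → ι') (x : ι →₀ Q) :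
    freeMap (φ : Q →ₐ[K] R) g x = push g (gradedToRingHom φ).toAddMonoidHom x := by
  induction x using Finsupp.induction_linear with
  | zero => simp
  | add x y hx hy => simp only [map_add, hx, hy]
  | single b a =>
    rw [freeMap_single, push_single]
    rfl

/-- The comparison of standard resolutions over a bijective homomorphism of modules. -/
def standardComparison (hφ : Function.Surjective φ) (f : GradedHomOver φ 𝒩 𝒩')
    (hf : Function.Injective f.toFun) (hfs : ∀ j, ∀ x ∈ 𝒩' j, ∃ y ∈ 𝒩 j, f.toFun y = x) :
    Comparison φ (resolution 𝒬 𝒩) (resolution ℛ 𝒩') where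
  g n := (stageHom φ f n).g
  deg_eq n := (stageHom φ f n).deg_eq
  e_eq n b := freeMap_eq_push _ _
  g_zero_bijective := by
    constructor
    · rintro ⟨j, x, hx⟩ ⟨j', x', hx'⟩ h
      obtain rfl : j = j' := congrArg (fun b : (Σ j : ℤ, 𝒩' j) => b.1) h
      have h' : f.toFun x = f.toFun x' := congrArg (fun b : (Σ j : ℤ, 𝒩' j) => (b.2 : N')) h
      obtain rfl := hf h'
      rfl
    · rintro ⟨j, x, hx⟩
      obtain ⟨y, hy, rfl⟩ := hfs j x hx
      exact ⟨⟨j, y, hy⟩, rfl⟩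
  g_one_surjective := by
    rintro ⟨j, x, hx, hxj⟩
    have hs : Function.Surjective (stageHom φ f 0).g := by
      rintro ⟨j, x, hx⟩
      obtain ⟨y, hy, rfl⟩ := hfs j x hx
      exact ⟨⟨j, y, hy⟩, rfl⟩
    obtain ⟨y, hy, hyx⟩ := exists_push_eq (𝒳 := ringPiece ℛ) (𝒴 := ringPiece 𝒬)
      (f := (gradedToRingHom φ).toAddMonoidHom) (stageHom φ f 0).deg_eq hs
      (exists_mem_ringPiece_map_eq hφ) hxj
    rw [← freeMap_eq_push] at hyx
    subst hyx
    refine ⟨⟨j, y, ?_, hy⟩, rfl⟩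
    -- The lift `y` of the relation `x` is again a relation because `f` is injective.
    have hx' : augmentation R 𝒩' (freeMap (φ : Q →ₐ[K] R) (stageHom φ f 0).g y) = 0 := hx
    exact hf (((augmentation_freeMap φ f y).symm.trans hx').trans (map_zero _).symm)
  exists_rel := by
    intro b i a ha ha0
    let b' : Σ j : ℤ, 𝒩 j := b
    -- `Ker φ` annihilates `N`, which embeds in an `R`-module; so `a` times the basis vector is a
    -- relation.
    refine ⟨(⟨i + b'.1, Finsupp.single b a, ?_, ?_⟩ : (stage 𝒬 𝒩 0).Gen 𝒬), rfl, rfl⟩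
    · change augmentation Q 𝒩 (Finsupp.single b' a) = 0
      rw [augmentation, Finsupp.linearCombination_single]
      apply hf
      rw [f.map_smul, ha0, zero_smul, map_zero]
    · exact single_mem_strandOf (𝒳 := ringPiece 𝒬) (mem_ringPiece_of_mem (by
        change (i : ℤ) = i + b'.1 - b'.1
        rw [add_sub_cancel_right]) ha)
  exact_source := resolution_vanishes 𝒬 𝒩
  exact_target := resolution_vanishes ℛ 𝒩'

/-- The homomorphism of residue fields, as a semilinear map. -/
def residueMap (φ : 𝒬 →ₐᵍ[K] ℛ) : Residue 𝒬 →ₛₗ[gradedToRingHom φ] Residue ℛ where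
  toFun := (residueHom φ).toFun
  map_add' := map_add _
  map_smul' := (residueHom φ).map_smul

theorem push_toResidue_freeMap {ι ι' : Type u} (g : ι → ι') (x : ι →₀ Q) :
    push id (toResidue ℛ).toAddMonoidHom (freeMap (φ : Q →ₐ[K] R) g x) =
      push g (residueMap φ).toAddMonoidHom (push id (toResidue 𝒬).toAddMonoidHom x) := by
  rw [freeMap_eq_push, push_push, push_push]
  rfl

/-- If `φ a` has zero component in degree zero, then the degree-zero component of `a` lies in `Ker
φ`, hence is zero. -/
theorem residueMap_injective (hlow : ∀ i < 2, ∀ a ∈ 𝒬 i, φ a = 0 → a = 0) :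
    Function.Injective (residueMap φ) := by
  rw [injective_iff_map_eq_zero]
  intro x hx
  obtain ⟨a, rfl⟩ := Ideal.Quotient.mk_surjective x
  have hx' : φ a ∈ (HomogeneousIdeal.irrelevant ℛ).toIdeal :=
    Ideal.Quotient.eq_zero_iff_mem.1 hx
  have h0 : GradedRing.proj ℛ 0 (φ a) = 0 := (HomogeneousIdeal.mem_irrelevant_iff ℛ _).1 hx'
  rw [GradedRing.proj_apply, ← map_directSumDecompose 𝒬 ℛ φ] at h0
  rw [Ideal.Quotient.eq_zero_iff_mem, HomogeneousIdeal.mem_iff,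
    HomogeneousIdeal.mem_irrelevant_iff]
  exact hlow 0 (by omega) _ (SetLike.coe_mem _) h0

theorem exists_residueMap_eq (hφ : Function.Surjective φ) (j : ℤ) (x : Residue ℛ)
    (hx : x ∈ residuePiece ℛ j) : ∃ y ∈ residuePiece 𝒬 j, residueMap φ y = x := by
  unfold residuePiece at hx ⊢
  split_ifs at hx ⊢
  · obtain ⟨r, rfl⟩ := Ideal.Quotient.mk_surjective x
    obtain ⟨a, rfl⟩ := hφ r
    exact ⟨Ideal.Quotient.mk _ a, trivial, rfl⟩
  · rw [AddSubgroup.mem_bot] at hx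
    exact ⟨0, zero_mem _, by rw [hx, map_zero]⟩

theorem reduction_residueMap (hφ : Function.Surjective φ)
    (hlow : ∀ i < 2, ∀ a ∈ 𝒬 i, φ a = 0 → a = 0) :
    Reduction φ (residueMap φ) (residuePiece 𝒬) (residuePiece ℛ) where
  mem := (residueHom φ).map_mem
  surj := exists_residueMap_eq hφ
  ker j y _ hy0 := by
    rw [(injective_iff_map_eq_zero _).1 (residueMap_injective hlow) y hy0]
    exact zero_mem _

/-- Start of the induction: `Q_+` acts on `k` as zero, which factors through any free module by zero
maps. -/
theorem isLinear_residuePiece {C : FreeComplex 𝒬}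
    (hv : ∀ (n : ℕ) (j : ℤ), j < n → C.Vanishes (residuePiece 𝒬) n j) :
    IsLinear C 0 (residuePiece 𝒬) where
  graded := isGradedModule_residuePiece 𝒬
  low j hj y hy := by
    rwa [residuePiece, if_neg (by omega), AddSubgroup.mem_bot] at hy
  factors a ha := by
    refine ⟨PUnit, 0, 0, fun y => ?_⟩
    obtain ⟨y, rfl⟩ := Ideal.Quotient.mk_surjective y
    exact (Ideal.Quotient.eq_zero_iff_mem.2 (Ideal.mul_mem_right y _ ha)).symm
  vanishes n j hj := hv (n + 1) j (by simpa using hj)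

/-- The canonical homomorphism of Tor is injective on and below the diagonal if its source vanishes
below the diagonal. -/
theorem torMap_injective (hφ : Function.Surjective φ)
    (h0 : ∀ a ∈ 𝒬 0, ∃ c : K, algebraMap K Q c = a)
    (hlow : ∀ i < 2, ∀ a ∈ 𝒬 i, φ a = 0 → a = 0) (f : GradedHomOver φ 𝒩 𝒩')
    (hf : Function.Injective f.toFun) (hfs : ∀ j, ∀ x ∈ 𝒩' j, ∃ y ∈ 𝒩 j, f.toFun y = x)
    (hv : ∀ (n : ℕ) (j : ℤ), j < n → (resolution 𝒬 𝒩).Vanishes (residuePiece 𝒬) n j)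
    (i : ℕ) (j : ℤ) (hij : j ≤ i) : Function.Injective (torMap φ f i j) := by
  have h0R : ∀ r ∈ ℛ 0, ∃ c : K, algebraMap K R c = r := by
    intro r hr
    obtain ⟨a, ha, rfl⟩ := exists_mem_map_eq hφ hr
    obtain ⟨c, rfl⟩ := h0 a ha
    exact ⟨c, (AlgHomClass.commutes φ c).symm⟩
  have hk := isLinear_residuePiece hv
  have hπ := reduction_residueMap hφ hlow
  -- The module `k` with `q = 0` plays two roles: it controls the homology of `ℋ`, and it is the
  -- coefficient module under study.
  have key := ((standardComparison hφ f hf hfs).vanishes_and_injectiveAt hφ h0 hlow hk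
    (fun j hj => hv 0 j (by simpa using hj)) hπ i hk hπ).2 j (by simpa using hij)
  rw [injective_iff_map_eq_zero]
  intro t ht
  obtain ⟨⟨x, hx⟩, rfl⟩ := Submodule.mkQ_surjective _ t
  obtain ⟨y, hy, rfl⟩ := exists_mkQ_eq_of_mem_cycles hx
  have hb : (plus ℛ (stage ℛ 𝒩' i).ι).mkQ (chainMap φ f i y) ∈ boundaries ℛ 𝒩' i j :=
    (Submodule.Quotient.mk_eq_zero
      ((boundaries ℛ 𝒩' i j).comap (cycles ℛ 𝒩' i j).subtype)).1 ht
  obtain ⟨w, hw, hwy⟩ := (mkQ_mem_boundaries_iff h0R _).1 hb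
  have hmap : push id (toResidue ℛ).toAddMonoidHom (chainMap φ f i y) =
      (standardComparison hφ f hf hfs).map (residueMap φ) i
        (push id (toResidue 𝒬).toAddMonoidHom y) :=
    push_toResidue_freeMap _ y
  refine (Submodule.Quotient.mk_eq_zero _).2 ((mkQ_mem_boundaries_iff h0 y).2 ?_)
  exact key _ (push_toResidue_mem hy) ((mkQ_mem_cycles_iff hy).1 hx) ⟨w, hw, hwy.trans hmap⟩

end StandardComparison

/-- Only `regularity ≤ 0` matters here; it gives the vanishing above the diagonal. -/
theorem subsingleton_tor_of_isKoszulAlgebra {A : Type u} [CommRing A] [Algebra K A]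
    {𝒜 : ℕ → Submodule K A} [GradedAlgebra 𝒜] (h : IsKoszulAlgebra 𝒜) {i : ℕ} {j : ℤ}
    (hij : (i : ℤ) < j) : Subsingleton (Tor 𝒜 (residuePiece 𝒜) i j) := by
  by_contra hne
  have hnt := not_subsingleton_iff_nontrivial.1 hne
  have h1 : topDegree 𝒜 (residuePiece 𝒜) i - ((i : ℝ) : EReal) ≤ 0 :=
    (le_iSup (fun i : ℕ => topDegree 𝒜 (residuePiece 𝒜) i - ((i : ℝ) : EReal)) i).trans h.le
  have h2 : ((j : ℝ) : EReal) ≤ topDegree 𝒜 (residuePiece 𝒜) i := le_sSup ⟨j, hnt, rfl⟩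
  have h3 : ((j : ℝ) : EReal) - ((i : ℝ) : EReal) ≤ 0 := (EReal.sub_le_sub h2 le_rfl).trans h1
  rw [← EReal.coe_sub, EReal.coe_nonpos, sub_nonpos] at h3
  have h4 : j ≤ (i : ℤ) := by exact_mod_cast h3
  omega

/-- The square of the irrelevant ideal vanishes in degrees less than two. -/
theorem eq_zero_of_mem_irrelevant_sq {A : Type u} [CommRing A] [Algebra K A]
    {𝒜 : ℕ → Submodule K A} [GradedAlgebra 𝒜] {a : A}
    (ha : a ∈ (HomogeneousIdeal.irrelevant 𝒜).toIdeal ^ 2) {i : ℕ} (hi : i < 2) (hai : a ∈ 𝒜 i) :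
    a = 0 := by
  have hproj : ∀ x ∈ (HomogeneousIdeal.irrelevant 𝒜).toIdeal ^ 2, GradedRing.proj 𝒜 i x = 0 := by
    intro x hx
    rw [pow_two] at hx
    induction hx using Submodule.mul_induction_on' with
    | mem_mul_mem x hx y hy =>
      have hx' : GradedRing.proj 𝒜 0 x = 0 := (HomogeneousIdeal.mem_irrelevant_iff 𝒜 _).1 hx
      have hy' : GradedRing.proj 𝒜 0 y = 0 := (HomogeneousIdeal.mem_irrelevant_iff 𝒜 _).1 hy
      rw [GradedRing.proj_apply] at hx' hy' ⊢
      rw [DirectSum.decompose_mul, DirectSum.coe_mul_apply_eq_sum_antidiagonal]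
      refine Finset.sum_eq_zero fun p hp => ?_
      rw [Finset.HasAntidiagonal.mem_antidiagonal] at hp
      rcases Nat.eq_zero_or_pos p.1 with h | h
      · rw [h, hx', zero_mul]
      · have : p.2 = 0 := by omega
        rw [this, hy', mul_zero]
    | add x _ y _ hx hy => rw [map_add, hx, hy, add_zero]
  have := hproj a ha
  rwa [GradedRing.proj_apply, DirectSum.decompose_of_mem_same 𝒜 hai] at this

end KoszulTor

end

theorem mainTheorem7 {K : Type v} [Field K]
    {Q R : Type u} [CommRing Q] [Algebra K Q] [CommRing R] [Algebra K R]
    (𝒬 : ℕ → Submodule K Q) [GradedAlgebra 𝒬] (ℛ : ℕ → Submodule K R) [GradedAlgebra ℛ]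
    (hQ : KoszulTor.IsStandardGraded 𝒬)
    (φ : 𝒬 →ₐᵍ[K] ℛ) (hφ : Function.Surjective φ)
    (hJ : RingHom.ker φ ≤ (HomogeneousIdeal.irrelevant 𝒬).toIdeal ^ 2) :
    (KoszulTor.IsKoszulAlgebra 𝒬 → KoszulTor.IsSmall φ) ∧
    (∀ (M : Type u) [AddCommGroup M] [Module R M] [Module Q M]
      (hM : ∀ (q : Q) (m : M), q • m = φ q • m)
      (ℳ : ℤ → AddSubgroup M), KoszulTor.IsGradedModule ℛ ℳ →
      KoszulTor.IsSmall φ → KoszulTor.IsKoszulModule 𝒬 ℳ →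
      ∀ (i : ℕ) (j : ℤ),
        Function.Injective (KoszulTor.torMap φ (KoszulTor.idOver φ hM ℳ) i j)) := by
  have hlow : ∀ i < 2, ∀ a ∈ 𝒬 i, φ a = 0 → a = 0 := fun i hi a ha h =>
    KoszulTor.eq_zero_of_mem_irrelevant_sq (hJ h) hi ha
  refine ⟨fun hK i j => ?_, fun M _ _ _ hM ℳ _ _ hK i j => ?_⟩
  · rcases le_or_gt j i with hij | hij
    · refine KoszulTor.torMap_injective hφ hQ.zero_eq hlow _
        (KoszulTor.residueMap_injective hlow) (KoszulTor.exists_residueMap_eq hφ)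
        (fun n l hl => ?_) i j hij
      -- Below the diagonal `Tor^Q(k, k)` vanishes for degree reasons.
      have hres : ∀ l < 0, ∀ x ∈ KoszulTor.residuePiece 𝒬 l, x = 0 := fun l hl x hx => by
        rwa [KoszulTor.residuePiece, if_neg (by omega), AddSubgroup.mem_bot] at hx
      exact KoszulTor.resolution_vanishes_of_low hQ.zero_eq hres n
        (KoszulTor.isGradedModule_residuePiece 𝒬) hres l (by simpa using hl)
    · have := KoszulTor.subsingleton_tor_of_isKoszulAlgebra hK hij
      exact Function.injective_of_subsingleton _
  -- Off the diagonal the source is zero. On it, the Koszul hypothesis on `M` gives the vanishing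
  -- below the diagonal that `torMap_injective` needs.
  · rcases eq_or_ne (i : ℤ) j with hij | hij
    · exact KoszulTor.torMap_injective hφ hQ.zero_eq hlow _ Function.injective_id
        (fun l x hx => ⟨x, hx, rfl⟩)
        (fun n l hl => KoszulTor.vanishes_of_subsingleton_tor hQ.zero_eq (hK n l (by omega)))
        i j hij.ge
    · have := hK i j hij
      exact Function.injective_of_subsingleton _
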